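/- Let $f:\mathbb{R}^n\times\mathbb{R}^n\times\mathbb{R}\times\mathbb{R}^p\to\mathbb{R}^n$, $(x,y,t,w)\mapsto f(x,y,t;w)$, be continuous and continuously differentiable in $(x,y,w)$, with derivative in $(x,y,w)$ jointly continuous in all variables. Let $\tau>0$, $T>0$, $w\in\mathbb{R}^p$, let $\phi:(-\infty,0]\to\mathbb{R}^n$ be continuous, and suppose that the delay differential equation $$\dot h(t)=f(h(t),h(t-\tau),t;w)\quad(0\le t\le T),\qquad h(t)=\phi(t)\quad(t\le 0)$$ has a solution $h$ on $[0,T]$. Let the loss function $L:\mathbb{R}^n\to\mathbb{R}$ be differentiable at $h(T)$. Below, $\partial f/\partial x$, $\partial f/\partial y$, $\partial f/\partial w$ are the partial Jacobians, and row vectors are identified with column vectors. For all parameters, delays, final times and states at time $0$ near $w,\tau,T,\phi(0)$ (with the values of $\phi$ on $(-\infty,0)$ kept fixed) the delay equation has a solution up to the final time, and the final state is unique; so the loss $L(h(T))$ is a function of these data near the given ones. The same holds, for each $s\in[0,T]$, if the equation is restarted at time $s$ with any state $\xi$ near $h(s)$ and with the unchanged history $h|_{(-\infty,s)}$; the gradient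 at $\xi=h(s)$ of the resulting loss is denoted by $\partial L(h(T))/\partial h(s)$. The adjoint equation $$\dot\lambda(t)=-\lambda(t)^{\top}\frac{\partial f}{\partial x}\big(h(t),h(t-\tau),t;w\big)-\lambda(t+\tau)^{\top}\frac{\partial f}{\partial y}\big(h(t+\tau),h(t),t+\tau;w\big)\,\chi_{[0,T-\tau]}(t),\qquad \lambda(T)=\nabla L(h(T)),$$ has a continuous solution $\lambda$ on $[0,T]$ (at $t=T-\tau$, where the right-hand side may jump, $\dot\lambda$ is the left-hand derivative), and every such solution is the adjoint, that is, for every $s\in[0,T]$ the derivative $\partial L(h(T))/\partial h(s)$ exists and equals $\lambda(s)$. The following derivatives of the loss exist and are given by $$\frac{dL}{dw}=\int_T^0-\lambda(t)^{\top}\frac{\partial f}{\partial w}\big(h(t),h(t-\tau),t;w\big)\,dt,$$ $$\frac{dL}{d\tau}=\int_T^0\lambda(t)^{\top}\frac{\partial f}{\partial y}\big(h(t),h(t-\tau),t;w\big)\,\dot h(t-\tau)\,dt\qquad\text{if }\phi\text{ is continuously differentiable on }(-\infty,0],$$ $$\frac{dL}{dh_0}=\lambda(0),$$ $$\frac{dL}{dT}=\lambda(T)^{\top}f\big(h(T),h(T-\tau),T;w\big).$$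 Here $dL/dw$, $dL/d\tau$ and $dL/dT$ are taken with the other data and $\phi$ fixed, and $dL/dh_0$ is the gradient with respect to the state $h_0=h(0)$, at $h_0=\phi(0)$, with the history $\phi$ on $(-\infty,0)$ fixed. -/

import Mathlib

open scoped Topology

namespace NDDE

/-- The space `ℝⁿ` with its Euclidean inner product. -/
abbrev Vec (n : ℕ) : Type := EuclideanSpace ℝ (Fin n)

/-- A vector field `f(x, y, t; w)`: `x` is the current state, `y` the delayed state, `t` the time
and `w` the parameter vector. -/
abbrev Field (n p : ℕ) : Type := Vec n → Vec n → ℝ → Vec p → Vec n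

/-- `f(x, y, t; w)` is jointly continuous and is continuously differentiable in `(x, y, w)`,
with a derivative that is jointly continuous in all arguments.  No differentiability in the
time `t` is asked. -/
structure IsC1 {n p : ℕ} (f : Field n p) : Prop where
  continuous : Continuous fun q : Vec n × Vec n × ℝ × Vec p => f q.1 q.2.1 q.2.2.1 q.2.2.2
  differentiable : ∀ t : ℝ, Differentiable ℝ fun q : Vec n × Vec n × Vec p => f q.1 q.2.1 t q.2.2
  continuous_fderiv : Continuous fun r : ℝ × (Vec n × Vec n × Vec p) =>
    fderiv ℝ (fun q : Vec n × Vec n × Vec p => f q.1 q.2.1 r.1 q.2.2) r.2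

/-- The partial Jacobian of `f` in the current state. -/
noncomputable def dState {n p : ℕ} (f : Field n p) (x y : Vec n) (t : ℝ) (w : Vec p) :
    Vec n →L[ℝ] Vec n :=
  fderiv ℝ (fun x' => f x' y t w) x

/-- The partial Jacobian of `f` in the delayed state. -/
noncomputable def dDelay {n p : ℕ} (f : Field n p) (x y : Vec n) (t : ℝ) (w : Vec p) :
    Vec n →L[ℝ] Vec n :=
  fderiv ℝ (fun y' => f x y' t w) y

/-- The partial Jacobian of `f` in the parameters. -/
noncomputable def dParam {n p : ℕ} (f : Field n p) (x y : Vec n) (t : ℝ) (w : Vec p) :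
    Vec p →L[ℝ] Vec n :=
  fderiv ℝ (fun w' => f x y t w') w

/-- The product `vᵀ A` of a (transposed) vector with a Jacobian, read as a vector. -/
noncomputable def transposeMul {m n : ℕ} (v : Vec n) (A : Vec m →L[ℝ] Vec n) : Vec m :=
  ContinuousLinearMap.adjoint A v

/-- `h` solves the delay equation `h'(t) = f(h(t), h(t - τ), t; w)` on `[s, T]` with history `ψ`
before the starting time `s` and with the state `ξ` at time `s`.  As usual for delay equations,
`h'` is the right-hand derivative: if `ξ` is not the limit of the history at `s`, then the
right-hand side of the equation jumps at `t = s + τ`; wherever it is continuous, `h` is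
differentiable in the two-sided sense. -/
structure IsTrajectory {n p : ℕ} (f : Field n p) (τ : ℝ) (w : Vec p) (s T : ℝ)
    (ψ : ℝ → Vec n) (ξ : Vec n) (h : ℝ → Vec n) : Prop where
  history : ∀ t < s, h t = ψ t
  start : h s = ξ
  continuousOn : ContinuousOn h (Set.Icc s T)
  deriv_right : ∀ t ∈ Set.Ico s T,
    HasDerivWithinAt h (f (h t) (h (t - τ)) t w) (Set.Ici t) t

/-- `x` is the state at time `T` of a solution of the delay equation on `[s, T]`. -/
def IsOutput {n p : ℕ} (f : Field n p) (τ : ℝ) (w : Vec p) (s T : ℝ)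
    (ψ : ℝ → Vec n) (ξ : Vec n) (x : Vec n) : Prop :=
  ∃ h : ℝ → Vec n, IsTrajectory f τ w s T ψ ξ h ∧ h T = x

/-- The loss `L(h(T))` as a function of all the data of the delay equation.  It is meaningful
wherever there is exactly one output. -/
noncomputable def loss {n p : ℕ} (L : Vec n → ℝ) (f : Field n p) (τ : ℝ) (w : Vec p) (s T : ℝ)
    (ψ : ℝ → Vec n) (ξ : Vec n) : ℝ :=
  L (Classical.epsilon fun x => IsOutput f τ w s T ψ ξ x)

/-- `lam` solves the adjoint equation along the trajectory `h`, a delay equation run backwards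
from `lam(T) = ∇L(h(T))`.  Its right-hand side may jump at `t = T - τ`, where the equation, with the
characteristic function of the closed interval `[0, T - τ]`, holds for the left-hand derivative;
at every other `t` in `(0, T)` the derivative is then a two-sided one. -/
structure IsAdjoint {n p : ℕ} (L : Vec n → ℝ) (f : Field n p) (τ : ℝ) (w : Vec p) (T : ℝ)
    (h lam : ℝ → Vec n) : Prop where
  continuousOn : ContinuousOn lam (Set.Icc 0 T)
  terminal : lam T = gradient L (h T)
  deriv_left : ∀ t ∈ Set.Ioc 0 T,
    HasDerivWithinAt lam
      (-transposeMul (lam t) (dState f (h t) (h (t - τ)) t w)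
        - (Set.Icc 0 (T - τ)).indicator
            (fun r => transposeMul (lam (r + τ)) (dDelay f (h (r + τ)) (h r) (r + τ) w)) t)
      (Set.Iic t) t

end NDDE

/-! The loss is linearised by pairing the adjoint with a difference of trajectories; no variational
equation is solved. Let `h` be the given trajectory and `u` the one for nearby data, with the same
history before `s`. Differentiate `⟨lam, u - h⟩` and integrate over `[s, T]`. The `∂f/∂x` term of
the adjoint equation cancels the linear part of `f` in the current state. The advanced term, shifted
by `τ`, cancels the linear part in the delayed state; the shift loses nothing, because `u - h`
vanishes before `s` and the indicator stops at `T - τ`. This is `IsAdjoint.inner_sub_inner`.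

What is left of `⟨lam(T), u(T) - h(T)⟩` is `⟨lam(s), ξ - h(s)⟩`, the integral of `lam` against
`∂f/∂w (w' - w)`, the integral against `∂f/∂y` times the increment of the delayed state caused by
the new delay, and a Taylor remainder. The remainder is of smaller order because `u` depends on the
data in a Lipschitz way (`IsTrajectory.exists_perturbation`); hence `IsAdjoint.exists_expansion`.
The gradients in the state and in the parameters are read off from it. For the delay, `u` must also
be replaced by `h` in the delayed increment, at a quadratic cost. For the final time, `h` is
continued past `T` and the chain rule applies.

Solvability, uniqueness and stability come from Volterra integral equations, whose operator
contracts in an exponentially weighted sup norm. Since `f` is only locally Lipschitz, its states are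
clamped to a ball; the clamp is invisible as long as the solution stays in that ball. The adjoint
equation is solved by the same result in reversed time. -/

namespace NDDE

/-! ### Volterra integral equations: contraction, stability, existence. -/

section Volterra

variable {E : Type*} [NormedAddCommGroup E]

/-- A causal operator `G` on functions which is Lipschitz in the running supremum norm on
`[a, b]`. -/
structure IsVolterra (a b K : ℝ) (G : (ℝ → E) → ℝ → E) : Prop where
  nonneg : 0 ≤ K
  integrable : ∀ u : ℝ → E, Continuous u → IntervalIntegrable (G u) MeasureTheory.volume a b
  lipschitz : ∀ u v : ℝ → E, ∀ r ∈ Set.Icc a b, ∀ M : ℝ,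
    (∀ ρ ∈ Set.Icc a r, ‖u ρ - v ρ‖ ≤ M) → ‖G u r - G v r‖ ≤ K * M

namespace IsVolterra

variable {a b K : ℝ} {G : (ℝ → E) → ℝ → E}

theorem congr (hG : IsVolterra a b K G) {u v : ℝ → E} (huv : Set.EqOn u v (Set.Icc a b)) :
    Set.EqOn (G u) (G v) (Set.Icc a b) := by
  intro r hr
  have h := hG.lipschitz u v r hr 0 fun ρ hρ => by
    rw [huv ⟨hρ.1, hρ.2.trans hr.2⟩, sub_self, norm_zero]
  rw [mul_zero] at h
  exact sub_eq_zero.1 (norm_le_zero_iff.1 h)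

theorem mono (hG : IsVolterra a b K G) {c : ℝ} (hac : a ≤ c) (hcb : c ≤ b) :
    IsVolterra a c K G where
  nonneg := hG.nonneg
  integrable u hu := (hG.integrable u hu).mono_set (by
    rw [Set.uIcc_of_le hac, Set.uIcc_of_le (hac.trans hcb)]
    exact Set.Icc_subset_Icc_right hcb)
  lipschitz u v r hr := hG.lipschitz u v r ⟨hr.1, hr.2.trans hcb⟩

theorem intervalIntegrable (hG : IsVolterra a b K G) (hab : a ≤ b) {u : ℝ → E}
    (hu : ContinuousOn u (Set.Icc a b)) : IntervalIntegrable (G u) MeasureTheory.volume a b := by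
  have hc : Continuous (Set.IccExtend hab ((Set.Icc a b).domRestrict u)) :=
    (continuousOn_iff_continuous_domRestrict.1 hu).Icc_extend'
  refine (hG.integrable _ hc).congr ?_
  rw [Set.uIoc_of_le hab]
  intro r hr
  refine hG.congr (fun t ht => ?_) (Set.Ioc_subset_Icc_self hr)
  rw [Set.IccExtend_of_mem hab _ ht, Set.domRestrict_apply]

theorem intervalIntegrable_left (hG : IsVolterra a b K G) {u : ℝ → E}
    (hu : ContinuousOn u (Set.Icc a b)) {t : ℝ} (ht : t ∈ Set.Icc a b) :
    IntervalIntegrable (G u) MeasureTheory.volume a t :=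
  (hG.mono ht.1 ht.2).intervalIntegrable ht.1 (hu.mono (Set.Icc_subset_Icc_right ht.2))

variable [NormedSpace ℝ E]

/-- Integrating `K * D * exp ((2K+1)(r - a))` produces the factor `K / (2K+1) ≤ 1/2`, so in the norm
weighted by this exponential the integral operator halves distances, however long the interval is.
-/
theorem norm_integral_sub_le (hG : IsVolterra a b K G) {u v : ℝ → E}
    (hu : ContinuousOn u (Set.Icc a b)) (hv : ContinuousOn v (Set.Icc a b)) {D : ℝ} (hD : 0 ≤ D)
    (huv : ∀ ρ ∈ Set.Icc a b, ‖u ρ - v ρ‖ ≤ D * Real.exp ((2 * K + 1) * (ρ - a)))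
    {t : ℝ} (ht : t ∈ Set.Icc a b) :
    ‖(∫ r in a..t, G u r) - ∫ r in a..t, G v r‖
      ≤ D / 2 * Real.exp ((2 * K + 1) * (t - a)) := by
  have hK := hG.nonneg
  rw [← intervalIntegral.integral_sub (hG.intervalIntegrable_left hu ht)
    (hG.intervalIntegrable_left hv ht)]
  have hcont : Continuous fun r : ℝ =>
      D / 2 * (Real.exp ((2 * K + 1) * (r - a)) * (2 * K + 1)) := by fun_prop
  have hint : (∫ r in a..t, D / 2 * (Real.exp ((2 * K + 1) * (r - a)) * (2 * K + 1)))
      = D / 2 * Real.exp ((2 * K + 1) * (t - a)) - D / 2 * Real.exp ((2 * K + 1) * (a - a)) := by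
    refine intervalIntegral.integral_eq_sub_of_hasDerivAt
      (f := fun r => D / 2 * Real.exp ((2 * K + 1) * (r - a))) (fun r _ => ?_)
      (hcont.intervalIntegrable _ _)
    have h1 : HasDerivAt (fun r : ℝ => (2 * K + 1) * (r - a)) (2 * K + 1) r := by
      simpa using ((hasDerivAt_id r).sub_const a).const_mul (2 * K + 1)
    exact h1.exp.const_mul _
  refine (intervalIntegral.norm_integral_le_of_norm_le ht.1 (.of_forall fun r hr => ?_)
    (hcont.intervalIntegrable _ _)).trans (hint.le.trans ?_)
  · have hr' : r ∈ Set.Icc a b := ⟨hr.1.le, hr.2.trans ht.2⟩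
    refine (hG.lipschitz u v r hr' (D * Real.exp ((2 * K + 1) * (r - a)))
      fun ρ hρ => (huv ρ ⟨hρ.1, hρ.2.trans hr'.2⟩).trans ?_).trans ?_
    · gcongr
      exact hρ.2
    · have : 0 ≤ D * Real.exp ((2 * K + 1) * (r - a)) := by positivity
      nlinarith
  · have : 0 ≤ D / 2 * Real.exp ((2 * K + 1) * (a - a)) := by positivity
    linarith

/-- Stability of the solution of a Volterra equation with respect to approximate solutions. -/
theorem norm_sub_le (hG : IsVolterra a b K G) {u v : ℝ → E}
    (hu : ContinuousOn u (Set.Icc a b)) (hv : ContinuousOn v (Set.Icc a b)) {ξ : E} {δ : ℝ}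
    (hu' : ∀ t ∈ Set.Icc a b, u t = ξ + ∫ r in a..t, G u r)
    (hv' : ∀ t ∈ Set.Icc a b, ‖v t - (ξ + ∫ r in a..t, G v r)‖ ≤ δ) {t : ℝ}
    (ht : t ∈ Set.Icc a b) : ‖u t - v t‖ ≤ 2 * Real.exp ((2 * K + 1) * (b - a)) * δ := by
  have hK := hG.nonneg
  have hab : a ≤ b := ht.1.trans ht.2
  have hcont : ContinuousOn (fun ρ => ‖u ρ - v ρ‖ * Real.exp (-((2 * K + 1) * (ρ - a))))
      (Set.Icc a b) := (hu.sub hv).norm.mul (by fun_prop)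
  obtain ⟨t₀, ht₀, hmax⟩ := isCompact_Icc.exists_isMaxOn ⟨a, Set.left_mem_Icc.2 hab⟩ hcont
  set D := ‖u t₀ - v t₀‖ * Real.exp (-((2 * K + 1) * (t₀ - a))) with hDdef
  have hD : 0 ≤ D := by positivity
  have hbound : ∀ ρ ∈ Set.Icc a b, ‖u ρ - v ρ‖ ≤ D * Real.exp ((2 * K + 1) * (ρ - a)) := by
    intro ρ hρ
    have h1 : ‖u ρ - v ρ‖ * Real.exp (-((2 * K + 1) * (ρ - a))) ≤ D := hmax hρ
    rwa [Real.exp_neg, ← div_eq_mul_inv, div_le_iff₀ (Real.exp_pos _)] at h1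
  have hδ : 0 ≤ δ := (norm_nonneg _).trans (hv' t ht)
  -- `D` is the weighted distance of `u` and `v`, attained at `t₀`. There the integral operator
  -- contributes at most `D / 2` and the defect of `v` at most `δ`; absorbing gives `D ≤ 2 * δ`.
  have hkey : D ≤ δ + D / 2 := by
    have h1 := hG.norm_integral_sub_le hu hv hD hbound ht₀
    have h2 : ‖u t₀ - v t₀‖ ≤ D / 2 * Real.exp ((2 * K + 1) * (t₀ - a)) + δ := by
      have : u t₀ - v t₀ = ((∫ r in a..t₀, G u r) - ∫ r in a..t₀, G v r)
          - (v t₀ - (ξ + ∫ r in a..t₀, G v r)) := by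
        rw [hu' t₀ ht₀]; abel
      rw [this]
      exact (_root_.norm_sub_le _ _).trans (add_le_add h1 (hv' t₀ ht₀))
    have h3 : Real.exp (-((2 * K + 1) * (t₀ - a))) ≤ 1 := by
      rw [Real.exp_le_one_iff]
      have := mul_nonneg (by linarith : 0 ≤ 2 * K + 1) (sub_nonneg.2 ht₀.1)
      linarith
    calc D ≤ (D / 2 * Real.exp ((2 * K + 1) * (t₀ - a)) + δ)
          * Real.exp (-((2 * K + 1) * (t₀ - a))) := by
          rw [hDdef]; gcongr
      _ = D / 2 * (Real.exp ((2 * K + 1) * (t₀ - a)) * Real.exp (-((2 * K + 1) * (t₀ - a))))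
          + δ * Real.exp (-((2 * K + 1) * (t₀ - a))) := by ring
      _ ≤ D / 2 * 1 + δ * 1 := by
          rw [← Real.exp_add, add_neg_cancel, Real.exp_zero]
          gcongr
      _ = δ + D / 2 := by ring
  calc ‖u t - v t‖ ≤ D * Real.exp ((2 * K + 1) * (t - a)) := hbound t ht
    _ ≤ (2 * δ) * Real.exp ((2 * K + 1) * (b - a)) := by
        gcongr
        · linarith
        · exact ht.2
    _ = _ := by ring

theorem eqOn (hG : IsVolterra a b K G) {u v : ℝ → E}
    (hu : ContinuousOn u (Set.Icc a b)) (hv : ContinuousOn v (Set.Icc a b)) {ξ : E}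
    (hu' : ∀ t ∈ Set.Icc a b, u t = ξ + ∫ r in a..t, G u r)
    (hv' : ∀ t ∈ Set.Icc a b, v t = ξ + ∫ r in a..t, G v r) : Set.EqOn u v (Set.Icc a b) := by
  intro t ht
  have h := hG.norm_sub_le hu hv (δ := 0) hu' (fun t ht => by rw [← hv' t ht]; simp) ht
  rw [mul_zero] at h
  exact sub_eq_zero.1 (norm_le_zero_iff.1 h)

/-- Existence for Volterra equations: the integral operator contracts in a weighted norm. -/
theorem exists_solution [CompleteSpace E] (hG : IsVolterra a b K G) (hab : a ≤ b) (ξ : E) :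
    ∃ u : ℝ → E, Continuous u ∧ ∀ t ∈ Set.Icc a b, u t = ξ + ∫ r in a..t, G u r := by
  let e : ℝ → ℝ := fun t => Real.exp ((2 * K + 1) * (t - a))
  have he : Continuous e := by fun_prop
  have he0 : ∀ t, e t ≠ 0 := fun t => (Real.exp_pos _).ne'
  -- The weight is built into the unknown: the plain sup distance of `v₁` and `v₂` is the weighted
  -- distance of `W v₁` and `W v₂`, so the Banach fixed point theorem applies in the usual space of
  -- continuous functions.
  let W : C(Set.Icc a b, E) → ℝ → E := fun v t => e t • Set.IccExtend hab v t
  have hW : ∀ v, Continuous (W v) := fun v => he.smul v.continuous.Icc_extend'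
  have hcont : ∀ v : C(Set.Icc a b, E), Continuous fun t : Set.Icc a b =>
      (e t)⁻¹ • (ξ + ∫ r in a..(t : ℝ), G (W v) r) := by
    intro v
    refine ((he.comp continuous_subtype_val).inv₀ fun t => he0 t.1).smul
      (continuous_const.add ?_)
    have h1 : ContinuousOn (fun t => ∫ r in a..t, G (W v) r) (Set.uIcc a b) :=
      intervalIntegral.continuousOn_primitive_interval'
        (hG.integrable _ (hW v)) Set.left_mem_uIcc
    rw [Set.uIcc_of_le hab] at h1
    exact continuousOn_iff_continuous_domRestrict.1 h1
  let Φ : C(Set.Icc a b, E) → C(Set.Icc a b, E) := fun v => ⟨_, hcont v⟩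
  have hΦ : ContractingWith (1 / 2) Φ := by
    refine ⟨by
      rw [← NNReal.coe_lt_coe]; norm_num, LipschitzWith.of_dist_le_mul fun v₁ v₂ => ?_⟩
    rw [ContinuousMap.dist_le (by positivity)]
    intro t
    have h1 := hG.norm_integral_sub_le (hW v₁).continuousOn (hW v₂).continuousOn
      (dist_nonneg (x := v₁) (y := v₂)) (fun ρ hρ => ?_) t.2
    · simp only [Φ, ContinuousMap.coe_mk]
      rw [dist_eq_norm, ← smul_sub, add_sub_add_left_eq_sub, norm_smul, norm_inv,
        Real.norm_of_nonneg (Real.exp_pos _).le, inv_mul_le_iff₀ (Real.exp_pos _)]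
      refine h1.trans (le_of_eq ?_)
      push_cast
      ring
    · simp only [W]
      rw [← smul_sub, norm_smul, Real.norm_of_nonneg (Real.exp_pos _).le, mul_comm,
        Set.IccExtend_of_mem hab _ hρ, Set.IccExtend_of_mem hab _ hρ, ← dist_eq_norm]
      gcongr
      exact ContinuousMap.dist_apply_le_dist _
  have : Nonempty C(Set.Icc a b, E) := ⟨0⟩
  refine ⟨W (hΦ.fixedPoint Φ), hW _, fun t ht => ?_⟩
  have h1 := DFunLike.congr_fun (hΦ.fixedPoint_isFixedPt) ⟨t, ht⟩
  simp only [Φ, ContinuousMap.coe_mk] at h1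
  conv_lhs => simp only [W]
  rw [Set.IccExtend_of_mem hab _ ht, ← h1, smul_inv_smul₀ (he0 t)]

end IsVolterra

end Volterra

/-! ### From one-sided to two-sided derivatives. -/

section OneSided

variable {E : Type*} [NormedAddCommGroup E] [NormedSpace ℝ E]

/-- A continuous function is differentiable wherever its right-hand derivative is continuous. -/
theorem hasDerivAt_of_deriv_right {u g : ℝ → E} {a b t : ℝ} (ht : t ∈ Set.Ioo a b)
    (hu : ContinuousOn u (Set.Icc a b))
    (hd : ∀ r ∈ Set.Ioo a b, HasDerivWithinAt u (g r) (Set.Ici r) r)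
    (hg : ContinuousAt g t) : HasDerivAt u (g t) t := by
  rw [hasDerivAt_iff_isLittleO, Asymptotics.isLittleO_iff]
  intro c hc
  obtain ⟨δ, hδ, hball⟩ := Metric.eventually_nhds_iff_ball.1
    ((Metric.tendsto_nhds.1 hg c hc).and (Ioo_mem_nhds ht.1 ht.2))
  -- The mean value inequality for right-hand derivatives is applied to `z ↦ u z - z • g t`, whose
  -- right-hand derivative `g z - g t` has norm at most `c` near `t`.
  have key : ∀ x ∈ Metric.ball t δ, ∀ y ∈ Metric.ball t δ, x ≤ y →
      ‖u y - u x - (y - x) • g t‖ ≤ c * (y - x) := by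
    intro x hx y hy hxy
    have hsub : Set.Icc x y ⊆ Metric.ball t δ := by
      rw [Real.ball_eq_Ioo] at hx hy ⊢
      exact fun z hz => ⟨hx.1.trans_le hz.1, hz.2.trans_lt hy.2⟩
    have h1 := norm_image_sub_le_of_norm_deriv_right_le_segment
      (f := fun z => u z - z • g t) (f' := fun z => g z - g t) (a := x) (b := y) (C := c)
      ((hu.mono fun z hz => Set.Ioo_subset_Icc_self (hball z (hsub hz)).2).sub (by fun_prop))
      (fun z hz => (hd z (hball z (hsub ⟨hz.1, hz.2.le⟩)).2).sub (by
        simpa using ((hasDerivAt_id z).smul_const (g t)).hasDerivWithinAt))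
      (fun z hz => by
        rw [← dist_eq_norm]
        exact (hball z (hsub ⟨hz.1, hz.2.le⟩)).1.le) y ⟨hxy, le_rfl⟩
    convert h1 using 2
    rw [sub_smul]
    abel
  filter_upwards [Metric.ball_mem_nhds t hδ] with x hx
  rcases le_total t x with h | h
  · rw [Real.norm_of_nonneg (sub_nonneg.2 h)]
    exact key t (Metric.mem_ball_self hδ) x hx h
  · have := key x hx t (Metric.mem_ball_self hδ) h
    rw [Real.norm_of_nonpos (sub_nonpos.2 h), neg_sub]
    refine le_trans (le_of_eq ?_) this
    rw [← norm_neg]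
    congr 1
    rw [sub_smul, sub_smul]
    abel

theorem hasDerivWithinAt_comp_neg_Ici {u : ℝ → E} {g : E} {t : ℝ}
    (hu : HasDerivWithinAt u g (Set.Iic t) t) :
    HasDerivWithinAt (fun r => u (-r)) (-g) (Set.Ici (-t)) (-t) := by
  have hn : HasDerivWithinAt (fun r : ℝ => -r) (-1) (Set.Ici (-t)) (-t) :=
    (hasDerivAt_neg (-t)).hasDerivWithinAt
  have h := HasDerivWithinAt.scomp (t' := Set.Iic t) (-t) (by simpa using hu) hn
    (fun r hr => Set.mem_Iic.2 (neg_le_of_neg_le hr))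
  simpa [Function.comp_def] using h

/-- A continuous function is differentiable wherever its left-hand derivative is continuous. -/
theorem hasDerivAt_of_deriv_left {u g : ℝ → E} {a b t : ℝ} (ht : t ∈ Set.Ioo a b)
    (hu : ContinuousOn u (Set.Icc a b))
    (hd : ∀ r ∈ Set.Ioo a b, HasDerivWithinAt u (g r) (Set.Iic r) r)
    (hg : ContinuousAt g t) : HasDerivAt u (g t) t := by
  have h := hasDerivAt_of_deriv_right (u := fun r => u (-r)) (g := fun r => -g (-r))
    (a := -b) (b := -a) (t := -t) ⟨neg_lt_neg ht.2, neg_lt_neg ht.1⟩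
    (hu.comp continuous_neg.continuousOn fun r hr =>
      ⟨le_neg_of_le_neg hr.2, neg_le_of_neg_le hr.1⟩)
    (fun r hr => by
      have := hasDerivWithinAt_comp_neg_Ici
        (hd (-r) ⟨lt_neg_of_lt_neg hr.2, neg_lt_of_neg_lt hr.1⟩)
      simpa using this)
    (ContinuousAt.neg (ContinuousAt.comp (by simpa using hg) continuousAt_neg))
  have h2 := HasDerivAt.scomp t h (hasDerivAt_neg t)
  simpa [Function.comp_def] using h2

end OneSided

end NDDE

/-! ### Clamping, gluing to a history, and estimates for the field. -/

namespace NDDE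

/-- The radial retraction onto the closed ball of radius `R`. -/
noncomputable def clamp {E : Type*} [NormedAddCommGroup E] [NormedSpace ℝ E] (R : ℝ) (x : E) : E :=
  (R / max R ‖x‖) • x

section Clamp

variable {E : Type*} [NormedAddCommGroup E] [NormedSpace ℝ E] {R : ℝ}

theorem clamp_of_norm_le (hR : 0 < R) {x : E} (hx : ‖x‖ ≤ R) : clamp R x = x := by
  rw [clamp, max_eq_left hx, div_self hR.ne', one_smul]

theorem norm_clamp_le (hR : 0 < R) (x : E) : ‖clamp R x‖ ≤ R := by
  have h : 0 < max R ‖x‖ := lt_max_of_lt_left hR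
  rw [clamp, norm_smul, Real.norm_of_nonneg (by positivity), div_mul_eq_mul_div, div_le_iff₀ h]
  exact mul_le_mul_of_nonneg_left (le_max_right _ _) hR.le

theorem norm_clamp_sub_le (hR : 0 < R) (x y : E) : ‖clamp R x - clamp R y‖ ≤ 2 * ‖x - y‖ := by
  have ha : 0 < max R ‖x‖ := lt_max_of_lt_left hR
  have hb : 0 < max R ‖y‖ := lt_max_of_lt_left hR
  have hab : |max R ‖y‖ - max R ‖x‖| ≤ ‖x - y‖ := by
    rw [max_comm R, max_comm R]
    refine (abs_max_sub_max_le_abs _ _ _).trans ?_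
    rw [norm_sub_rev]
    exact abs_norm_sub_norm_le y x
  have hb1 : R / max R ‖y‖ ≤ 1 := (div_le_one hb).2 (le_max_left _ _)
  have ha1 : ‖x‖ / max R ‖x‖ ≤ 1 := (div_le_one ha).2 (le_max_right _ _)
  -- One part moves the point under a fixed scaling factor, the other changes the factor. Each costs
  -- at most `‖x - y‖`, which is where the Lipschitz constant 2 comes from.
  have hsplit : clamp R x - clamp R y = (R / max R ‖y‖) • (x - y)
      + ((R / max R ‖y‖) * ((max R ‖y‖ - max R ‖x‖) / max R ‖x‖)) • x := by
    have : R / max R ‖x‖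
        = R / max R ‖y‖ + (R / max R ‖y‖) * ((max R ‖y‖ - max R ‖x‖) / max R ‖x‖) := by
      field_simp
      ring
    rw [clamp, clamp, this, add_smul, smul_sub]
    abel
  have h0 : 0 ≤ R / max R ‖y‖ := by positivity
  calc ‖clamp R x - clamp R y‖
      ≤ (R / max R ‖y‖) * ‖x - y‖
        + (R / max R ‖y‖) * (|max R ‖y‖ - max R ‖x‖| * (‖x‖ / max R ‖x‖)) := by
        rw [hsplit]
        refine (norm_add_le _ _).trans (le_of_eq ?_)
        rw [norm_smul, norm_smul, Real.norm_of_nonneg h0, norm_mul, Real.norm_of_nonneg h0,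
          norm_div, Real.norm_eq_abs, Real.norm_of_nonneg ha.le]
        ring
    _ ≤ 1 * ‖x - y‖ + 1 * (‖x - y‖ * 1) := by gcongr
    _ = 2 * ‖x - y‖ := by ring

theorem continuous_clamp (hR : 0 < R) : Continuous (clamp R : E → E) :=
  (LipschitzWith.of_dist_le_mul (K := 2) fun x y => by
    rw [dist_eq_norm, dist_eq_norm]; exact norm_clamp_sub_le hR x y).continuous

end Clamp

/-- The function equal to `ψ` before time `s` and to `u` from time `s` on. -/
noncomputable def glue {E : Type*} (ψ : ℝ → E) (s : ℝ) (u : ℝ → E) (r : ℝ) : E :=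
  open Classical in if r < s then ψ r else u r

section Glue

variable {E : Type*} {ψ u : ℝ → E} {s r : ℝ}

theorem glue_of_lt (h : r < s) : glue ψ s u r = ψ r := if_pos h

theorem glue_of_le (h : s ≤ r) : glue ψ s u r = u r := if_neg h.not_gt

theorem glue_eq_self (h : ∀ t < s, u t = ψ t) : glue ψ s u = u := by
  funext t
  rcases lt_or_ge t s with ht | ht
  · rw [glue_of_lt ht, h t ht]
  · rw [glue_of_le ht]

theorem measurable_glue [TopologicalSpace E] [MeasurableSpace E] [BorelSpace E]
    (hψ : Continuous ψ) (hu : Continuous u) : Measurable (glue ψ s u) := by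
  classical
  unfold glue
  exact Measurable.ite measurableSet_Iio hψ.measurable hu.measurable

theorem continuousAt_glue [TopologicalSpace E] (hψ : Continuous ψ) (hu : Continuous u)
    (h : r ≠ s) : ContinuousAt (glue ψ s u) r := by
  rcases h.lt_or_gt with h | h
  · refine hψ.continuousAt.congr ?_
    filter_upwards [Iio_mem_nhds h] with x hx using (glue_of_lt hx).symm
  · refine hu.continuousAt.congr ?_
    filter_upwards [Ioi_mem_nhds h] with x hx using (glue_of_le (le_of_lt hx)).symm

/-- Continuity from the right survives even at `s`, where the state may jump away from the history.
This is what lets the integral equation be differentiated from the right at every time. -/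
theorem continuousWithinAt_glue [TopologicalSpace E] (hψ : Continuous ψ) (hu : Continuous u)
    (r : ℝ) : ContinuousWithinAt (glue ψ s u) (Set.Ici r) r := by
  rcases eq_or_ne r s with rfl | h
  · exact hu.continuousWithinAt.congr (fun x hx => glue_of_le hx) (glue_of_le le_rfl)
  · exact (continuousAt_glue hψ hu h).continuousWithinAt

end Glue

variable {n p : ℕ} {f : Field n p}

namespace IsC1

theorem hasFDerivAt (hf : IsC1 f) (t : ℝ) (q : Vec n × Vec n × Vec p) :
    HasFDerivAt (fun q : Vec n × Vec n × Vec p => f q.1 q.2.1 t q.2.2)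
      (fderiv ℝ (fun q : Vec n × Vec n × Vec p => f q.1 q.2.1 t q.2.2) q) q :=
  (hf.differentiable t q).hasFDerivAt

/-- The derivative is bounded on the compact set `[a, b]` times the ball, and the ball is convex. No
global constant need exist, hence the clamping. -/
theorem exists_lipschitz (hf : IsC1 f) (a b R : ℝ) :
    ∃ K, 0 ≤ K ∧ ∀ t ∈ Set.Icc a b, ∀ q ∈ Metric.closedBall (0 : Vec n × Vec n × Vec p) R,
      ∀ q' ∈ Metric.closedBall (0 : Vec n × Vec n × Vec p) R,
      ‖f q.1 q.2.1 t q.2.2 - f q'.1 q'.2.1 t q'.2.2‖ ≤ K * ‖q - q'‖ := by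
  obtain ⟨K, hK⟩ := (isCompact_Icc.prod (isCompact_closedBall (0 : Vec n × Vec n × Vec p) R)
    ).exists_bound_of_continuousOn (s := Set.Icc a b ×ˢ _) hf.continuous_fderiv.continuousOn
  refine ⟨max K 0, le_max_right _ _, fun t ht q hq q' hq' => ?_⟩
  exact Convex.norm_image_sub_le_of_norm_hasFDerivWithin_le
    (f := fun q : Vec n × Vec n × Vec p => f q.1 q.2.1 t q.2.2)
    (fun x _ => (hf.hasFDerivAt t x).hasFDerivWithinAt)
    (fun x hx => (hK (t, x) ⟨ht, hx⟩).trans (le_max_left _ _))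
    (convex_closedBall _ _) hq' hq

theorem dState_eq (hf : IsC1 f) (x y : Vec n) (t : ℝ) (w : Vec p) :
    dState f x y t w = (fderiv ℝ (fun q : Vec n × Vec n × Vec p => f q.1 q.2.1 t q.2.2)
      (x, y, w)).comp (.inl ℝ _ _) :=
  (HasFDerivAt.comp (f := fun e => (e, y, w)) x (hf.hasFDerivAt t (x, y, w))
    (hasFDerivAt_prodMk_left x (y, w))).fderiv

theorem dDelay_eq (hf : IsC1 f) (x y : Vec n) (t : ℝ) (w : Vec p) :
    dDelay f x y t w = (fderiv ℝ (fun q : Vec n × Vec n × Vec p => f q.1 q.2.1 t q.2.2)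
      (x, y, w)).comp ((ContinuousLinearMap.inr ℝ _ _).comp (.inl ℝ _ _)) :=
  (HasFDerivAt.comp (f := fun e => (x, e, w)) y (hf.hasFDerivAt t (x, y, w))
    (HasFDerivAt.comp (f := fun e => (e, w)) y (hasFDerivAt_prodMk_right x (y, w))
      (hasFDerivAt_prodMk_left y w))).fderiv

theorem dParam_eq (hf : IsC1 f) (x y : Vec n) (t : ℝ) (w : Vec p) :
    dParam f x y t w = (fderiv ℝ (fun q : Vec n × Vec n × Vec p => f q.1 q.2.1 t q.2.2)
      (x, y, w)).comp ((ContinuousLinearMap.inr ℝ _ _).comp (.inr ℝ _ _)) :=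
  (HasFDerivAt.comp (f := fun e => (x, y, e)) w (hf.hasFDerivAt t (x, y, w))
    (HasFDerivAt.comp (f := fun e => (y, e)) w (hasFDerivAt_prodMk_right x (y, w))
      (hasFDerivAt_prodMk_right y w))).fderiv

theorem fderiv_apply (hf : IsC1 f) (x y : Vec n) (t : ℝ) (w : Vec p) (v : Vec n × Vec n × Vec p) :
    fderiv ℝ (fun q : Vec n × Vec n × Vec p => f q.1 q.2.1 t q.2.2) (x, y, w) v
      = dState f x y t w v.1 + dDelay f x y t w v.2.1 + dParam f x y t w v.2.2 := by
  rw [hf.dState_eq, hf.dDelay_eq, hf.dParam_eq]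
  simp only [ContinuousLinearMap.comp_apply, ContinuousLinearMap.inl_apply,
    ContinuousLinearMap.inr_apply]
  rw [← map_add, ← map_add]
  simp

section Continuity

variable {X : Type*} [TopologicalSpace X] {x y : X → Vec n} {t : X → ℝ} {w : X → Vec p}

theorem continuous_dState (hf : IsC1 f) (hx : Continuous x) (hy : Continuous y)
    (ht : Continuous t) (hw : Continuous w) :
    Continuous fun z => dState f (x z) (y z) (t z) (w z) := by
  simp_rw [hf.dState_eq]
  exact (hf.continuous_fderiv.comp (ht.prodMk (hx.prodMk (hy.prodMk hw)))).clm_comp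
    continuous_const

theorem continuous_dDelay (hf : IsC1 f) (hx : Continuous x) (hy : Continuous y)
    (ht : Continuous t) (hw : Continuous w) :
    Continuous fun z => dDelay f (x z) (y z) (t z) (w z) := by
  simp_rw [hf.dDelay_eq]
  exact (hf.continuous_fderiv.comp (ht.prodMk (hx.prodMk (hy.prodMk hw)))).clm_comp
    continuous_const

theorem continuous_dParam (hf : IsC1 f) (hx : Continuous x) (hy : Continuous y)
    (ht : Continuous t) (hw : Continuous w) :
    Continuous fun z => dParam f (x z) (y z) (t z) (w z) := by
  simp_rw [hf.dParam_eq]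
  exact (hf.continuous_fderiv.comp (ht.prodMk (hx.prodMk (hy.prodMk hw)))).clm_comp
    continuous_const

end Continuity

/-- First-order expansion of `f` in `(x, y, w)`, uniform along a compact path. -/
theorem exists_uniform_expansion (hf : IsC1 f) {a b : ℝ} {c : ℝ → Vec n × Vec n × Vec p}
    (hc : Continuous c) {ε : ℝ} (hε : 0 < ε) :
    ∃ δ > 0, ∀ t ∈ Set.Icc a b, ∀ q : Vec n × Vec n × Vec p, ‖q - c t‖ ≤ δ →
      ‖f q.1 q.2.1 t q.2.2 - f (c t).1 (c t).2.1 t (c t).2.2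
        - fderiv ℝ (fun q : Vec n × Vec n × Vec p => f q.1 q.2.1 t q.2.2) (c t) (q - c t)‖
        ≤ ε * ‖q - c t‖ := by
  have hk : IsCompact ((fun t => (t, c t)) '' Set.Icc a b) :=
    isCompact_Icc.image (continuous_id.prodMk hc)
  -- Uniform continuity at the points of the compact graph of `c`, where the second point is free to
  -- leave the graph.
  have h := hk.uniformContinuousAt_of_continuousAt _
    (fun x _ => hf.continuous_fderiv.continuousAt) (Metric.dist_mem_uniformity hε)
  obtain ⟨δ, hδ, hδ'⟩ := Metric.mem_uniformity_dist.1 h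
  refine ⟨δ / 2, half_pos hδ, fun t ht q hq => ?_⟩
  refine Convex.norm_image_sub_le_of_norm_hasFDerivWithin_le'
    (f := fun q : Vec n × Vec n × Vec p => f q.1 q.2.1 t q.2.2)
    (s := Metric.closedBall (c t) (δ / 2))
    (fun x _ => (hf.hasFDerivAt t x).hasFDerivWithinAt) (fun x hx => ?_)
    (convex_closedBall _ _) (Metric.mem_closedBall_self (half_pos hδ).le)
    (by rwa [Metric.mem_closedBall, dist_eq_norm])
  have hd : dist (t, c t) (t, x) < δ := by
    rw [Prod.dist_eq, dist_self, max_eq_right dist_nonneg, dist_comm]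
    exact (Metric.mem_closedBall.1 hx).trans_lt (half_lt_self hδ)
  have := hδ' hd ⟨t, ht, rfl⟩
  rw [← dist_eq_norm, dist_comm]
  exact le_of_lt this

end IsC1

end NDDE

/-! ### Trajectories as solutions of a clamped Volterra equation; uniqueness. -/

namespace NDDE

variable {n p : ℕ} {f : Field n p}

/-- The right-hand side of the delay equation with the states clamped to the ball of radius `R`,
for a function `u` on `[s, ∞)` continuing the history `ψ`. -/
noncomputable def clampedRHS (f : Field n p) (R τ : ℝ) (w : Vec p) (ψ : ℝ → Vec n) (s : ℝ)
    (u : ℝ → Vec n) (r : ℝ) : Vec n :=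
  f (clamp R (u r)) (clamp R (glue ψ s u (r - τ))) r w

section ClampedRHS

variable {R τ s B : ℝ} {w : Vec p} {ψ u : ℝ → Vec n}

theorem clampedRHS_eq (hR : 0 < R) {r : ℝ} (h1 : ‖u r‖ ≤ R) (h2 : ‖glue ψ s u (r - τ)‖ ≤ R) :
    clampedRHS f R τ w ψ s u r = f (u r) (glue ψ s u (r - τ)) r w := by
  rw [clampedRHS, clamp_of_norm_le hR h1, clamp_of_norm_le hR h2]

theorem measurable_clampedRHS (hf : IsC1 f) (hR : 0 < R) (hψ : Continuous ψ)
    (hu : Continuous u) : Measurable (clampedRHS f R τ w ψ s u) := by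
  have hc := (continuous_clamp (E := Vec n) hR).measurable
  exact hf.continuous.measurable.comp ((hc.comp hu.measurable).prodMk
    ((hc.comp ((measurable_glue hψ hu).comp (measurable_id.sub_const τ))).prodMk
      (measurable_id.prodMk measurable_const)))

/-- The clamped arguments stay in a ball on which `f` is Lipschitz, and the factor 2 is the
Lipschitz constant of `clamp`. The delayed argument is either common history, which cancels, or an
earlier value of the unknown, which the running supremum controls because `0 ≤ τ`. -/
theorem isVolterra_clampedRHS (hf : IsC1 f) (hR : 0 < R) (hψ : Continuous ψ) (hτ : 0 ≤ τ)
    {K R' : ℝ} (hK : 0 ≤ K) (hRR' : R ≤ R') (hw : ‖w‖ ≤ R')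
    (hlip : ∀ t ∈ Set.Icc s B, ∀ q ∈ Metric.closedBall (0 : Vec n × Vec n × Vec p) R',
      ∀ q' ∈ Metric.closedBall (0 : Vec n × Vec n × Vec p) R',
      ‖f q.1 q.2.1 t q.2.2 - f q'.1 q'.2.1 t q'.2.2‖ ≤ K * ‖q - q'‖) :
    IsVolterra s B (K * 2) (clampedRHS f R τ w ψ s) where
  nonneg := by positivity
  integrable u hu := by
    obtain ⟨C, hC⟩ := ((isCompact_closedBall (0 : Vec n) R).prod
      ((isCompact_closedBall (0 : Vec n) R).prod
        ((isCompact_uIcc (a := s) (b := B)).prod (isCompact_singleton (x := w))))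
      ).exists_bound_of_continuousOn hf.continuous.continuousOn
    rw [intervalIntegrable_iff]
    refine MeasureTheory.Measure.integrableOn_of_bounded (M := C) measure_Ioc_lt_top.ne
      (measurable_clampedRHS hf hR hψ hu).aestronglyMeasurable ?_
    refine (MeasureTheory.ae_restrict_iff' measurableSet_uIoc).2 (.of_forall fun r hr => ?_)
    exact hC (clamp R (u r), clamp R (glue ψ s u (r - τ)), r, w)
      ⟨mem_closedBall_zero_iff.2 (norm_clamp_le hR _), mem_closedBall_zero_iff.2
        (norm_clamp_le hR _), Set.uIoc_subset_uIcc hr, rfl⟩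
  lipschitz u v r hr M hM := by
    have hM0 : 0 ≤ M := (norm_nonneg _).trans (hM s ⟨le_rfl, hr.1⟩)
    have hmem : ∀ x y : Vec n, (clamp R x, clamp R y, w)
        ∈ Metric.closedBall (0 : Vec n × Vec n × Vec p) R' := fun x y => by
      rw [mem_closedBall_zero_iff, norm_prod_le_iff, norm_prod_le_iff]
      exact ⟨(norm_clamp_le hR _).trans hRR', (norm_clamp_le hR _).trans hRR', hw⟩
    refine (hlip r hr _ (hmem (u r) (glue ψ s u (r - τ))) _
      (hmem (v r) (glue ψ s v (r - τ)))).trans ?_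
    rw [mul_assoc]
    refine mul_le_mul_of_nonneg_left ?_ hK
    rw [norm_prod_le_iff, norm_prod_le_iff]
    refine ⟨(norm_clamp_sub_le hR _ _).trans ?_, (norm_clamp_sub_le hR _ _).trans ?_, ?_⟩
    · have := hM r ⟨hr.1, le_rfl⟩
      linarith
    · rcases lt_or_ge (r - τ) s with h | h
      · rw [glue_of_lt h, glue_of_lt h, sub_self, norm_zero]
        linarith
      · rw [glue_of_le h, glue_of_le h]
        have := hM (r - τ) ⟨h, by linarith⟩
        linarith
    · simp only [Prod.snd_sub, sub_self, norm_zero]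
      linarith

/-- Some Lipschitz constant that serves all fields clamped to a given ball. -/
theorem exists_isVolterra_clampedRHS (hf : IsC1 f) (s B : ℝ) (hR : 0 < R) (w : Vec p) :
    ∃ K, ∀ (τ : ℝ) (ψ : ℝ → Vec n), 0 ≤ τ → Continuous ψ →
      IsVolterra s B K (clampedRHS f R τ w ψ s) := by
  obtain ⟨K, hK, hlip⟩ := hf.exists_lipschitz s B (max R ‖w‖)
  exact ⟨K * 2, fun τ ψ hτ hψ =>
    isVolterra_clampedRHS hf hR hψ hτ hK (le_max_left _ _) (le_max_right _ _) hlip⟩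

end ClampedRHS

namespace IsTrajectory

variable {τ s B : ℝ} {w : Vec p} {ψ u v : ℝ → Vec n} {ξ : Vec n}

theorem glue_eq (hu : IsTrajectory f τ w s B ψ ξ u) : glue ψ s u = u :=
  glue_eq_self hu.history

theorem mono (hu : IsTrajectory f τ w s B ψ ξ u) {B' : ℝ} (h : B' ≤ B) :
    IsTrajectory f τ w s B' ψ ξ u where
  history := hu.history
  start := hu.start
  continuousOn := hu.continuousOn.mono (Set.Icc_subset_Icc_right h)
  deriv_right t ht := hu.deriv_right t ⟨ht.1, ht.2.trans_le h⟩

theorem congr_history (hu : IsTrajectory f τ w s B ψ ξ u) {ψ' : ℝ → Vec n}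
    (h : ∀ t < s, ψ t = ψ' t) : IsTrajectory f τ w s B ψ' ξ u where
  history t ht := (hu.history t ht).trans (h t ht)
  start := hu.start
  continuousOn := hu.continuousOn
  deriv_right := hu.deriv_right

theorem exists_bound (hu : IsTrajectory f τ w s B ψ ξ u) (hψ : Continuous ψ) (c : ℝ) :
    ∃ R, 0 < R ∧ ∀ r ∈ Set.Icc c B, ‖u r‖ ≤ R := by
  obtain ⟨C₁, h₁⟩ := (isCompact_Icc (a := c) (b := s)).exists_bound_of_continuousOn
    hψ.continuousOn
  obtain ⟨C₂, h₂⟩ := (isCompact_Icc (a := s) (b := B)).exists_bound_of_continuousOn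
    hu.continuousOn
  refine ⟨max 1 (max C₁ C₂), lt_max_of_lt_left one_pos, fun r hr => ?_⟩
  rcases lt_or_ge r s with h | h
  · rw [hu.history r h]
    exact (h₁ r ⟨hr.1, h.le⟩).trans ((le_max_left _ _).trans (le_max_right _ _))
  · exact (h₂ r ⟨h, hr.2⟩).trans ((le_max_right _ _).trans (le_max_right _ _))

theorem clampedRHS_eq (hu : IsTrajectory f τ w s B ψ ξ u) {R : ℝ} (hR : 0 < R) (hτ : 0 ≤ τ)
    (hb : ∀ r ∈ Set.Icc (s - τ) B, ‖u r‖ ≤ R) {r : ℝ} (hr : r ∈ Set.Icc s B) :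
    clampedRHS f R τ w ψ s u r = f (u r) (u (r - τ)) r w := by
  have := NDDE.clampedRHS_eq (f := f) (w := w) (ψ := ψ) (s := s) (τ := τ) hR
    (hb r ⟨by linarith [hr.1], hr.2⟩)
    (by rw [hu.glue_eq]; exact hb _ ⟨by linarith [hr.1], by linarith [hr.2]⟩)
  rwa [hu.glue_eq] at this

/-- A trajectory bounded by `R` never feels the clamp, so the fundamental theorem for right-hand
derivatives turns the delay equation into the clamped integral equation. -/
theorem integral_eq (hu : IsTrajectory f τ w s B ψ ξ u) {K R : ℝ} (hR : 0 < R) (hτ : 0 ≤ τ)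
    (hV : IsVolterra s B K (clampedRHS f R τ w ψ s))
    (hb : ∀ r ∈ Set.Icc (s - τ) B, ‖u r‖ ≤ R) {t : ℝ} (ht : t ∈ Set.Icc s B) :
    u t = ξ + ∫ r in s..t, clampedRHS f R τ w ψ s u r := by
  rw [intervalIntegral.integral_eq_sub_of_hasDeriv_right_of_le ht.1
    (hu.continuousOn.mono (Set.Icc_subset_Icc_right ht.2)) (fun r hr => ?_)
    (hV.intervalIntegrable_left hu.continuousOn ht), hu.start]
  · abel
  · rw [hu.clampedRHS_eq hR hτ hb ⟨hr.1.le, hr.2.le.trans ht.2⟩]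
    exact (hu.deriv_right r ⟨hr.1.le, hr.2.trans_le ht.2⟩).mono Set.Ioi_subset_Ici_self

/-- For a radius dominating both trajectories, they solve the same clamped Volterra equation. -/
theorem eqOn (hf : IsC1 f) (hψ : Continuous ψ) (hτ : 0 ≤ τ)
    (hu : IsTrajectory f τ w s B ψ ξ u) (hv : IsTrajectory f τ w s B ψ ξ v) :
    Set.EqOn u v (Set.Icc s B) := by
  obtain ⟨R₁, hR₁, h₁⟩ := hu.exists_bound hψ (s - τ)
  obtain ⟨R₂, hR₂, h₂⟩ := hv.exists_bound hψ (s - τ)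
  have hR : 0 < max R₁ R₂ := lt_max_of_lt_left hR₁
  obtain ⟨K, hK⟩ := exists_isVolterra_clampedRHS hf s B hR w
  exact (hK τ ψ hτ hψ).eqOn hu.continuousOn hv.continuousOn
    (fun t ht => hu.integral_eq hR hτ (hK τ ψ hτ hψ)
      (fun r hr => (h₁ r hr).trans (le_max_left _ _)) ht)
    (fun t ht => hv.integral_eq hR hτ (hK τ ψ hτ hψ)
      (fun r hr => (h₂ r hr).trans (le_max_right _ _)) ht)

/-- Converse to `integral_eq`: while the solution and the history stay in the ball, the clamp is
inactive. The integrand may jump at `s + τ` but is right-continuous, so right-hand differentiation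
recovers the equation everywhere. -/
theorem of_integral_eq (hf : IsC1 f) (hψ : Continuous ψ) (hu : Continuous u) (hτ : 0 < τ)
    {K R : ℝ} (hR : 0 < R) (hV : IsVolterra s B K (clampedRHS f R τ w ψ s)) (hsB : s ≤ B)
    (heq : ∀ t ∈ Set.Icc s B, u t = ξ + ∫ r in s..t, clampedRHS f R τ w ψ s u r)
    (hψb : ∀ r ∈ Set.Icc (s - τ) s, ‖ψ r‖ ≤ R) (hub : ∀ r ∈ Set.Icc s B, ‖u r‖ ≤ R) :
    IsTrajectory f τ w s B ψ ξ (glue ψ s u) where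
  history t ht := glue_of_lt ht
  start := by
    rw [glue_of_le le_rfl, heq s ⟨le_rfl, hsB⟩, intervalIntegral.integral_same, add_zero]
  continuousOn := hu.continuousOn.congr fun t ht => glue_of_le ht.1
  deriv_right t ht := by
    have htB : t ∈ Set.Icc s B := ⟨ht.1, ht.2.le⟩
    have hval : clampedRHS f R τ w ψ s u t
        = f (glue ψ s u t) (glue ψ s u (t - τ)) t w := by
      rw [NDDE.clampedRHS_eq hR (hub t htB), glue_of_le ht.1]
      rcases lt_or_ge (t - τ) s with h | h
      · rw [glue_of_lt h]
        exact hψb _ ⟨by linarith [ht.1], h.le⟩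
      · rw [glue_of_le h]
        exact hub _ ⟨h, by linarith [ht.2]⟩
    have hshift : Filter.Tendsto (fun r => r - τ) (𝓝[Set.Ici t] t) (𝓝[Set.Ici (t - τ)] (t - τ)) :=
      (continuous_id.sub continuous_const).continuousWithinAt.tendsto_nhdsWithin
        fun r hr => sub_le_sub_right hr τ
    have hcont : ContinuousWithinAt (clampedRHS f R τ w ψ s u) (Set.Ici t) t := by
      have hc := continuous_clamp (E := Vec n) hR
      have h1 : ContinuousWithinAt (fun r => clamp R (u r)) (Set.Ici t) t :=
        (hc.comp hu).continuousWithinAt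
      have h2 : ContinuousWithinAt (fun r => clamp R (glue ψ s u (r - τ))) (Set.Ici t) t :=
        hc.continuousAt.tendsto.comp
          ((continuousWithinAt_glue (s := s) hψ hu (t - τ)).tendsto.comp hshift)
      exact hf.continuous.continuousAt.comp_continuousWithinAt
        (h1.prodMk (h2.prodMk (continuousWithinAt_id.prodMk continuousWithinAt_const)))
    have hd := intervalIntegral.integral_hasDerivWithinAt_right (s := Set.Ici t) (t := Set.Ioi t)
      (hV.intervalIntegrable_left hu.continuousOn htB)
      ((measurable_clampedRHS hf hR hψ hu).stronglyMeasurable.stronglyMeasurableAtFilter)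
      (hcont.mono Set.Ioi_subset_Ici_self)
    rw [← hval]
    have hd' := hd.const_add ξ
    refine hd'.congr_of_eventuallyEq ?_ ?_
    · filter_upwards [Icc_mem_nhdsGE_of_mem ⟨le_rfl, ht.2⟩] with r hr
      have hr' : s ≤ r := ht.1.trans hr.1
      rw [glue_of_le hr', heq r ⟨hr', hr.2⟩]
    · rw [glue_of_le ht.1, heq t htB]

end IsTrajectory

theorem existsUnique_isOutput {τ s B : ℝ} {w : Vec p} {ψ u : ℝ → Vec n} {ξ : Vec n} (hf : IsC1 f)
    (hψ : Continuous ψ) (hτ : 0 ≤ τ) (hsB : s ≤ B) (hu : IsTrajectory f τ w s B ψ ξ u) :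
    ∃! x, IsOutput f τ w s B ψ ξ x := by
  refine ⟨u B, ⟨u, hu, rfl⟩, ?_⟩
  rintro x ⟨v, hv, rfl⟩
  exact IsTrajectory.eqOn hf hψ hτ hv hu ⟨hsB, le_rfl⟩

/-- Uniqueness of the output determines the value of the arbitrary choice in `loss`. -/
theorem loss_eq {τ s B : ℝ} {w : Vec p} {ψ u : ℝ → Vec n} {ξ : Vec n} (L : Vec n → ℝ)
    (hf : IsC1 f) (hψ : Continuous ψ) (hτ : 0 ≤ τ) (hsB : s ≤ B)
    (hu : IsTrajectory f τ w s B ψ ξ u) : loss L f τ w s B ψ ξ = L (u B) := by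
  have h : ∃ x, IsOutput f τ w s B ψ ξ x := ⟨u B, u, hu, rfl⟩
  rw [loss, (existsUnique_isOutput hf hψ hτ hsB hu).unique (Classical.epsilon_spec h)
    ⟨u, hu, rfl⟩]

theorem isOutput_congr_history {τ s B : ℝ} {w : Vec p} {ψ ψ' : ℝ → Vec n} {ξ : Vec n}
    (h : ∀ t < s, ψ t = ψ' t) : IsOutput f τ w s B ψ ξ = IsOutput f τ w s B ψ' ξ := by
  funext x
  exact propext ⟨fun ⟨u, hu, hx⟩ => ⟨u, hu.congr_history h, hx⟩,
    fun ⟨u, hu, hx⟩ => ⟨u, hu.congr_history fun t ht => (h t ht).symm, hx⟩⟩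

theorem loss_congr_history {τ s B : ℝ} {w : Vec p} {ψ ψ' : ℝ → Vec n} {ξ : Vec n}
    {L : Vec n → ℝ} (h : ∀ t < s, ψ t = ψ' t) :
    loss L f τ w s B ψ ξ = loss L f τ w s B ψ' ξ := by
  rw [loss, loss, isOutput_congr_history h]

end NDDE

/-! ### Stability under perturbation, and continuation in time. -/

namespace NDDE

variable {n p : ℕ} {f : Field n p}

theorem norm_glue_sub_le {E : Type*} [NormedAddCommGroup E] {h u : ℝ → E} {s B M : ℝ}
    (hM : 0 ≤ M) (hu : ∀ t ∈ Set.Icc s B, ‖u t - h t‖ ≤ M) {r : ℝ} (hr : r ≤ B) :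
    ‖glue h s u r - h r‖ ≤ M := by
  rcases lt_or_ge r s with hs | hs
  · rwa [glue_of_lt hs, sub_self, norm_zero]
  · rw [glue_of_le hs]
    exact hu r ⟨hs, hr⟩

namespace IsTrajectory

variable {τ s B : ℝ} {w : Vec p} {h : ℝ → Vec n}

/-- Solvability and Lipschitz stability of the delay equation near a given trajectory. -/
theorem exists_perturbation (hf : IsC1 f) (hh : Continuous h) (hτ : 0 < τ) (hsB : s ≤ B)
    (htr : IsTrajectory f τ w s B h (h s) h) :
    ∃ C, 0 ≤ C ∧ ∃ δ > 0, ∀ (w' : Vec p) (τ' : ℝ) (ξ : Vec n) (ω : ℝ), 0 < τ' → τ' ≤ τ + 1 →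
      ‖w' - w‖ ≤ δ → ‖ξ - h s‖ ≤ δ → 0 ≤ ω → ω ≤ δ →
      (∀ r ∈ Set.Icc s B, ‖h (r - τ') - h (r - τ)‖ ≤ ω) →
      ∃ u : ℝ → Vec n, Continuous u ∧ IsTrajectory f τ' w' s B h ξ (glue h s u) ∧
        (∀ t ∈ Set.Icc s B, ‖u t - h t‖ ≤ C * (‖ξ - h s‖ + ‖w' - w‖ + ω)) ∧
        (∀ t ∈ Set.Icc s B,
          ‖glue h s u (t - τ') - h (t - τ)‖ ≤ C * (‖ξ - h s‖ + ‖w' - w‖ + ω)) ∧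
        ∀ t ∈ Set.Icc s B,
          ‖f (u t) (glue h s u (t - τ')) t w' - f (h t) (h (t - τ)) t w‖
            ≤ C * (‖ξ - h s‖ + ‖w' - w‖ + ω) := by
  -- The window reaches back to `s - (τ + 1)` because perturbed delays up to `τ + 1` are allowed.
  obtain ⟨R₀, hR₀, hb⟩ := htr.exists_bound hh (s - (τ + 1))
  have hR : 0 < R₀ + 1 := by linarith
  set R' := R₀ + 1 + ‖w‖ + 1 with hR'
  have hw0 := norm_nonneg w
  obtain ⟨K, hK, hlip⟩ := hf.exists_lipschitz s B R'
  set A := 2 * Real.exp ((2 * (K * 2) + 1) * (B - s)) * (1 + K * (B - s)) with hA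
  have hBs : 0 ≤ B - s := sub_nonneg.2 hsB
  have hA0 : 0 ≤ A := by positivity
  -- Each of the three summands of `η` is at most `1 / (3 * A + 3)`, so `A * η ≤ 1`. The perturbed
  -- solution then stays within distance 1 of `h`, inside the ball of radius `R₀ + 1`.
  refine ⟨(K + 1) * (A + 1), by positivity, 1 / (3 * A + 3), by positivity,
    fun w' τ' ξ ω hτ' hτ'1 hw' hξ hω0 hω hωr => ?_⟩
  set η := ‖ξ - h s‖ + ‖w' - w‖ + ω with hη
  have hη0 : 0 ≤ η := by positivity
  have hηw : ‖w' - w‖ ≤ η := by linarith [norm_nonneg (ξ - h s)]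
  have hηω : ω ≤ η := by linarith [norm_nonneg (ξ - h s), norm_nonneg (w' - w)]
  have hAη : A * η ≤ 1 := by
    have h1 : η ≤ 3 * (1 / (3 * A + 3)) := by linarith
    calc A * η ≤ A * (3 * (1 / (3 * A + 3))) := by gcongr
      _ = A / (A + 1) := by field_simp
      _ ≤ 1 := (div_le_one (by linarith)).2 (by linarith)
  have hδ1 : 1 / (3 * A + 3) ≤ 1 := (div_le_one (by linarith)).2 (by linarith)
  have hww : ‖w'‖ ≤ R' := by
    have := norm_le_norm_add_norm_sub' w' w
    linarith
  have hV : IsVolterra s B (K * 2) (clampedRHS f (R₀ + 1) τ w h s) :=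
    isVolterra_clampedRHS hf hR hh hτ.le hK (by linarith) (by linarith) hlip
  have hV' : IsVolterra s B (K * 2) (clampedRHS f (R₀ + 1) τ' w' h s) :=
    isVolterra_clampedRHS hf hR hh hτ'.le hK (by linarith) hww hlip
  have hb1 : ∀ r ∈ Set.Icc (s - (τ + 1)) B, ‖h r‖ ≤ R₀ + 1 := fun r hr =>
    (hb r hr).trans (by linarith)
  have hmem : ∀ {x y : Vec n} {v : Vec p}, ‖x‖ ≤ R₀ + 1 → ‖y‖ ≤ R₀ + 1 → ‖v‖ ≤ R' →
      (x, y, v) ∈ Metric.closedBall (0 : Vec n × Vec n × Vec p) R' := fun hx hy hv => by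
    rw [mem_closedBall_zero_iff, norm_prod_le_iff, norm_prod_le_iff]
    exact ⟨hx.trans (by linarith), hy.trans (by linarith), hv⟩
  have hself : glue h s h = h := glue_eq_self fun _ _ => rfl
  obtain ⟨u, huc, hu⟩ := hV'.exists_solution hsB ξ
  -- The old trajectory `h` is treated as an approximate solution of the perturbed equation. Its
  -- defect is of order `η`, and `IsVolterra.norm_sub_le` turns this into closeness of `u` and `h`.
  have hdefect : ∀ t ∈ Set.Icc s B,
      ‖h t - (ξ + ∫ r in s..t, clampedRHS f (R₀ + 1) τ' w' h s h r)‖ ≤ (1 + K * (B - s)) * η := by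
    intro t ht
    have heq := htr.integral_eq hR hτ.le hV
      (fun r hr => hb1 r ⟨by linarith [hr.1], hr.2⟩) ht
    have hsplit : h t - (ξ + ∫ r in s..t, clampedRHS f (R₀ + 1) τ' w' h s h r)
        = -(ξ - h s) + ∫ r in s..t, (clampedRHS f (R₀ + 1) τ w h s h r
            - clampedRHS f (R₀ + 1) τ' w' h s h r) := by
      rw [intervalIntegral.integral_sub
        (hV.intervalIntegrable_left hh.continuousOn ht)
        (hV'.intervalIntegrable_left hh.continuousOn ht)]
      conv_lhs => rw [heq]
      abel
    have hint : ‖∫ r in s..t, (clampedRHS f (R₀ + 1) τ w h s h r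
            - clampedRHS f (R₀ + 1) τ' w' h s h r)‖ ≤ K * η * |t - s| := by
      refine intervalIntegral.norm_integral_le_of_norm_le_const fun r hr => ?_
      rw [Set.uIoc_of_le ht.1] at hr
      have hrB : r ∈ Set.Icc s B := ⟨hr.1.le, hr.2.trans ht.2⟩
      have e1 := hb1 r ⟨by linarith [hr.1], hrB.2⟩
      have e2 := hb1 (r - τ) ⟨by linarith [hr.1], by linarith [hrB.2]⟩
      have e3 := hb1 (r - τ') ⟨by linarith [hr.1], by linarith [hrB.2]⟩
      rw [NDDE.clampedRHS_eq hR e1 (by rwa [hself]), NDDE.clampedRHS_eq hR e1 (by rwa [hself]),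
        hself]
      refine (hlip r hrB _ (hmem e1 e2 (by linarith : ‖w‖ ≤ R')) _ (hmem e1 e3 hww)).trans ?_
      refine mul_le_mul_of_nonneg_left ?_ hK
      rw [norm_prod_le_iff, norm_prod_le_iff]
      refine ⟨by simpa using hη0, ?_, ?_⟩
      · change ‖h (r - τ) - h (r - τ')‖ ≤ η
        rw [norm_sub_rev]
        exact (hωr r hrB).trans hηω
      · change ‖w - w'‖ ≤ η
        rw [norm_sub_rev]
        exact hηw
    rw [hsplit]
    refine (norm_add_le _ _).trans ?_
    rw [norm_neg, abs_of_nonneg (sub_nonneg.2 ht.1)] at *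
    have h1 : K * η * (t - s) ≤ K * η * (B - s) := by
      gcongr
      exact ht.2
    have h2 : ‖ξ - h s‖ ≤ η := by linarith [norm_nonneg (w' - w)]
    linarith
  have huh : ∀ t ∈ Set.Icc s B, ‖u t - h t‖ ≤ A * η := by
    intro t ht
    refine (hV'.norm_sub_le huc.continuousOn hh.continuousOn hu hdefect ht).trans (le_of_eq ?_)
    rw [hA]; ring
  have hub : ∀ r ∈ Set.Icc s B, ‖u r‖ ≤ R₀ + 1 := by
    intro r hr
    have h1 := norm_le_norm_add_norm_sub' (u r) (h r)
    have h2 := hb r ⟨by linarith [hr.1], hr.2⟩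
    have h3 := huh r hr
    linarith
  have hgl : ∀ t ∈ Set.Icc s B, ‖glue h s u (t - τ') - h (t - τ)‖ ≤ (A + 1) * η := by
    intro t ht
    have h1 := norm_glue_sub_le (mul_nonneg hA0 hη0) huh (by linarith [ht.2] : t - τ' ≤ B)
    have h2 := norm_sub_le_norm_sub_add_norm_sub (glue h s u (t - τ')) (h (t - τ')) (h (t - τ))
    have h3 := hωr t ht
    linarith
  have hAK : (A + 1) * η ≤ (K + 1) * (A + 1) * η := by
    have : 0 ≤ K * ((A + 1) * η) := by positivity
    linarith
  refine ⟨u, huc, .of_integral_eq hf hh huc hτ' hR hV' hsB hu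
    (fun r hr => hb1 r ⟨by linarith [hr.1], hr.2.trans hsB⟩) hub,
    fun t ht => ?_, fun t ht => (hgl t ht).trans hAK, fun t ht => ?_⟩
  · have := huh t ht
    linarith
  · have e1 := hub t ht
    have e2 : ‖glue h s u (t - τ')‖ ≤ R₀ + 1 := by
      rcases lt_or_ge (t - τ') s with h1 | h1
      · rw [glue_of_lt h1]
        exact hb1 _ ⟨by linarith [ht.1], by linarith [ht.2]⟩
      · rw [glue_of_le h1]
        exact hub _ ⟨h1, by linarith [ht.2]⟩
    have e3 := hb1 t ⟨by linarith [ht.1], ht.2⟩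
    have e4 := hb1 (t - τ) ⟨by linarith [ht.1], by linarith [ht.2]⟩
    refine (hlip t ht _ (hmem e1 e2 hww) _ (hmem e3 e4 (by linarith : ‖w‖ ≤ R'))).trans ?_
    have h1 : ‖((u t, glue h s u (t - τ'), w') : Vec n × Vec n × Vec p)
        - (h t, h (t - τ), w)‖ ≤ (A + 1) * η := by
      rw [norm_prod_le_iff, norm_prod_le_iff]
      refine ⟨?_, hgl t ht, ?_⟩
      · have h5 := huh t ht
        change ‖u t - h t‖ ≤ _
        linarith
      · have : 0 ≤ A * η := by positivity
        change ‖w' - w‖ ≤ _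
        linarith
    calc K * _ ≤ K * ((A + 1) * η) := mul_le_mul_of_nonneg_left h1 hK
      _ ≤ (K + 1) * (A + 1) * η := by
        have : 0 ≤ (A + 1) * η := by positivity
        linarith

/-- A trajectory can be continued beyond its final time. -/
theorem exists_extension (hf : IsC1 f) (hh : Continuous h) (hτ : 0 < τ) (hsB : s ≤ B)
    (htr : IsTrajectory f τ w s B h (h s) h) :
    ∃ ε > 0, ∃ g : ℝ → Vec n, Continuous g ∧ IsTrajectory f τ w s (B + ε) g (g s) g ∧
      ∀ t ≤ B, g t = h t := by
  obtain ⟨R₀, hR₀, hb⟩ := htr.exists_bound hh (s - τ)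
  have hR : 0 < R₀ + 1 := by linarith
  obtain ⟨K, hK⟩ := exists_isVolterra_clampedRHS hf s (B + 1) hR w
  have hV := hK τ h hτ.le hh
  -- The clamped equation is solvable up to `B + 1` without further conditions. Its solution agrees
  -- with `h` up to `B`, where `‖h B‖ < R₀ + 1`, so by continuity it remains in the ball, and hence
  -- a true trajectory, for a short time beyond `B`.
  obtain ⟨u, huc, hu⟩ := hV.exists_solution (by linarith) (h s)
  have hVB := hV.mono hsB (by linarith)
  have huh : Set.EqOn u h (Set.Icc s B) :=
    hVB.eqOn huc.continuousOn hh.continuousOn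
      (fun t ht => hu t ⟨ht.1, by linarith [ht.2]⟩)
      (fun t ht => htr.integral_eq hR hτ.le hVB (fun r hr => (hb r hr).trans (by linarith)) ht)
  have huB : ∀ᶠ t in 𝓝 B, ‖u t‖ < R₀ + 1 := by
    refine huc.norm.continuousAt.eventually_lt continuousAt_const ?_
    rw [huh ⟨hsB, le_rfl⟩]
    exact (hb B ⟨by linarith, le_rfl⟩).trans_lt (by linarith)
  obtain ⟨δ, hδ, hball⟩ := Metric.eventually_nhds_iff_ball.1 huB
  have hε : 0 < min 1 (δ / 2) := lt_min one_pos (half_pos hδ)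
  have hub : ∀ r ∈ Set.Icc s (B + min 1 (δ / 2)), ‖u r‖ ≤ R₀ + 1 := by
    intro r hr
    rcases le_total r B with h1 | h1
    · rw [huh ⟨hr.1, h1⟩]
      exact (hb r ⟨by linarith [hr.1], h1⟩).trans (by linarith)
    · refine (hball r ?_).le
      have := hr.2.trans (add_le_add_right (min_le_right 1 (δ / 2)) B)
      rw [Metric.mem_ball, Real.dist_eq, abs_of_nonneg (sub_nonneg.2 h1)]
      linarith
  have hB1 : B + min 1 (δ / 2) ≤ B + 1 := add_le_add_right (min_le_left _ _) B
  have htr' : IsTrajectory f τ w s (B + min 1 (δ / 2)) h (h s) (glue h s u) :=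
    .of_integral_eq hf hh huc hτ hR (hV.mono (by linarith) hB1) (by linarith)
      (fun t ht => hu t ⟨ht.1, ht.2.trans hB1⟩)
      (fun r hr => (hb r ⟨hr.1, by linarith [hr.2]⟩).trans (by linarith)) hub
  have hgh : ∀ t ≤ B, glue h s u t = h t := by
    intro t ht
    rcases lt_or_ge t s with h1 | h1
    · exact glue_of_lt h1
    · rw [glue_of_le h1, huh ⟨h1, ht⟩]
  refine ⟨_, hε, glue h s u, ?_, ?_, hgh⟩
  · rw [continuous_iff_continuousAt]
    intro r
    rcases eq_or_ne r s with rfl | hr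
    · rw [continuousAt_iff_continuous_left_right]
      refine ⟨?_, continuousWithinAt_glue hh huc r⟩
      exact hh.continuousWithinAt.congr (fun x hx => hgh x (le_trans hx hsB)) (hgh r hsB)
    · exact continuousAt_glue hh huc hr
  · rw [htr'.start]
    exact htr'.congr_history fun t ht => (glue_of_lt ht).symm

end IsTrajectory

end NDDE

/-! ### The adjoint equation and the duality identity. -/

namespace NDDE

variable {n p : ℕ} {f : Field n p}

section TransposeMul

variable {m n : ℕ}

theorem inner_transposeMul (v : Vec n) (A : Vec m →L[ℝ] Vec n) (x : Vec m) :
    inner ℝ (transposeMul v A) x = inner ℝ v (A x) :=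
  ContinuousLinearMap.adjoint_inner_left A x v

theorem norm_transposeMul_sub_le (v v' : Vec n) (A : Vec m →L[ℝ] Vec n) :
    ‖transposeMul v A - transposeMul v' A‖ ≤ ‖A‖ * ‖v - v'‖ := by
  rw [transposeMul, transposeMul, ← map_sub]
  refine (ContinuousLinearMap.le_opNorm _ _).trans (le_of_eq ?_)
  rw [LinearIsometryEquiv.norm_map]

theorem continuous_transposeMul {X : Type*} [TopologicalSpace X] {v : X → Vec n}
    {A : X → Vec m →L[ℝ] Vec n} (hv : Continuous v) (hA : Continuous A) :
    Continuous fun x => transposeMul (v x) (A x) :=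
  (ContinuousLinearMap.adjoint.continuous.comp hA).clm_apply hv

end TransposeMul

/-- The adjoint equation has a solution: it is a linear Volterra equation in reversed time. -/
theorem exists_isAdjoint (hf : IsC1 f) (L : Vec n → ℝ) {τ T : ℝ} (hτ : 0 < τ) (hT : 0 < T)
    (w : Vec p) {h : ℝ → Vec n} (hh : Continuous h) : ∃ lam, IsAdjoint L f τ w T h lam := by
  have hhs : ∀ c : ℝ, Continuous fun r => h (r + c) := fun c =>
    hh.comp (continuous_id.add continuous_const)
  let a : ℝ → Vec n →L[ℝ] Vec n := fun t => dState f (h t) (h (t - τ)) t w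
  let b : ℝ → Vec n →L[ℝ] Vec n := fun t => dDelay f (h (t + τ)) (h t) (t + τ) w
  have ha : Continuous a := hf.continuous_dState hh (hh.comp (continuous_id.sub continuous_const))
    continuous_id continuous_const
  have hb : Continuous b := hf.continuous_dDelay (hhs τ) hh (continuous_id.add continuous_const)
    continuous_const
  obtain ⟨Ca, hCa⟩ := (isCompact_Icc (a := 0) (b := T)).exists_bound_of_continuousOn
    ha.continuousOn
  obtain ⟨Cb, hCb⟩ := (isCompact_Icc (a := 0) (b := T)).exists_bound_of_continuousOn
    hb.continuousOn
  have hCa0 : 0 ≤ Ca := (norm_nonneg _).trans (hCa 0 ⟨le_rfl, hT.le⟩)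
  have hCb0 : 0 ≤ Cb := (norm_nonneg _).trans (hCb 0 ⟨le_rfl, hT.le⟩)
  have hrev : Continuous fun r : ℝ => T - r := continuous_const.sub continuous_id
  -- This is the adjoint right-hand side in the time `r = T - t`: the advanced value `lam (t + τ)`
  -- becomes the delayed value `μ (r - τ)`, and `t ≤ T - τ` becomes `τ ≤ r`.
  let G : (ℝ → Vec n) → ℝ → Vec n := fun μ r => transposeMul (μ r) (a (T - r))
    + (Set.Ici τ).indicator (fun r => transposeMul (μ (r - τ)) (b (T - r))) r
  have hc1 : ∀ μ : ℝ → Vec n, Continuous μ →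
      Continuous fun r => transposeMul (μ r) (a (T - r)) := fun μ hμ =>
    continuous_transposeMul hμ (ha.comp hrev)
  have hc2 : ∀ μ : ℝ → Vec n, Continuous μ →
      Continuous fun r => transposeMul (μ (r - τ)) (b (T - r)) := fun μ hμ =>
    continuous_transposeMul (hμ.comp (continuous_id.sub continuous_const)) (hb.comp hrev)
  have hV : IsVolterra 0 T (Ca + Cb) G :=
    { nonneg := by positivity
      integrable := fun μ hμ => by
        refine ((hc1 μ hμ).intervalIntegrable _ _).add ?_
        rw [intervalIntegrable_iff]
        exact (intervalIntegrable_iff.1 ((hc2 μ hμ).intervalIntegrable _ _)).indicator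
          measurableSet_Ici
      lipschitz := fun u v r hr M hM => by
        have hM0 : 0 ≤ M := (norm_nonneg _).trans (hM 0 ⟨le_rfl, hr.1⟩)
        have hTr : T - r ∈ Set.Icc 0 T := ⟨by linarith [hr.2], by linarith [hr.1]⟩
        have e1 : ‖transposeMul (u r) (a (T - r)) - transposeMul (v r) (a (T - r))‖ ≤ Ca * M :=
          (norm_transposeMul_sub_le _ _ _).trans
            (mul_le_mul (hCa _ hTr) (hM r ⟨hr.1, le_rfl⟩) (norm_nonneg _) hCa0)
        have e2 : ‖(Set.Ici τ).indicator (fun r => transposeMul (u (r - τ)) (b (T - r))) r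
            - (Set.Ici τ).indicator (fun r => transposeMul (v (r - τ)) (b (T - r))) r‖
            ≤ Cb * M := by
          by_cases hτr : r ∈ Set.Ici τ
          · rw [Set.indicator_of_mem hτr, Set.indicator_of_mem hτr]
            exact (norm_transposeMul_sub_le _ _ _).trans
              (mul_le_mul (hCb _ hTr) (hM _ ⟨sub_nonneg.2 hτr, by linarith⟩) (norm_nonneg _) hCb0)
          · rw [Set.indicator_of_notMem hτr, Set.indicator_of_notMem hτr, sub_self, norm_zero]
            positivity
        rw [add_mul]
        simp only [G]
        rw [add_sub_add_comm]
        exact (norm_add_le _ _).trans (add_le_add e1 e2) }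
  obtain ⟨μ, hμc, hμ⟩ := hV.exists_solution hT.le (gradient L (h T))
  -- Because `[τ, ∞)` is closed, right-continuity holds also at the jump `r = τ`. Reversed, this is
  -- the left-hand derivative at `T - τ` with the closed interval `[0, T - τ]`.
  have hGr : ∀ r, ContinuousWithinAt (G μ) (Set.Ici r) r := by
    intro r
    refine (hc1 μ hμc).continuousWithinAt.add ?_
    rcases lt_or_ge r τ with hr | hr
    · refine ContinuousAt.continuousWithinAt ?_
      refine (continuousAt_const : ContinuousAt (fun _ => (0 : Vec n)) r).congr ?_
      filter_upwards [Iio_mem_nhds hr] with x hx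
      exact (Set.indicator_of_notMem (by simpa using hx) _).symm
    · exact (hc2 μ hμc).continuousWithinAt.congr
        (fun x hx => Set.indicator_of_mem (le_trans hr hx) _) (Set.indicator_of_mem hr _)
  have hGm : ∀ l, StronglyMeasurableAtFilter (G μ) l MeasureTheory.volume := fun l =>
    ((hc1 μ hμc).stronglyMeasurable.add
      ((hc2 μ hμc).stronglyMeasurable.indicator measurableSet_Ici)).stronglyMeasurableAtFilter
  have hμd : ∀ r ∈ Set.Ico 0 T, HasDerivWithinAt μ (G μ r) (Set.Ici r) r := by
    intro r hr
    have hd := intervalIntegral.integral_hasDerivWithinAt_right (s := Set.Ici r) (t := Set.Ioi r)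
      (hV.intervalIntegrable_left hμc.continuousOn ⟨hr.1, hr.2.le⟩) (hGm _)
      ((hGr r).mono Set.Ioi_subset_Ici_self)
    refine (hd.const_add (gradient L (h T))).congr_of_eventuallyEq ?_
      (hμ r ⟨hr.1, hr.2.le⟩)
    filter_upwards [Icc_mem_nhdsGE_of_mem ⟨le_rfl, hr.2⟩] with x hx
    exact hμ x ⟨hr.1.trans hx.1, hx.2⟩
  refine ⟨fun t => μ (T - t), (hμc.comp hrev).continuousOn, ?_, fun t ht => ?_⟩
  · simp only [sub_self]
    rw [hμ 0 ⟨le_rfl, hT.le⟩, intervalIntegral.integral_same, add_zero]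
  · have hinner : HasDerivWithinAt (fun r : ℝ => T - r) (-1) (Set.Iic t) t :=
      ((hasDerivAt_id t).const_sub T).hasDerivWithinAt
    have hd : HasDerivWithinAt (fun r => μ (T - r)) _ (Set.Iic t) t := HasDerivWithinAt.scomp t
      (hμd (T - t) ⟨by linarith [ht.2], by linarith [ht.1]⟩) hinner
      (fun r hr => Set.mem_Ici.2 (sub_le_sub_left hr T))
    refine hd.congr_deriv ?_
    simp only [G, a, b]
    symm
    rw [neg_one_smul, neg_add, sub_eq_add_neg, sub_sub_cancel]
    congr 2
    by_cases hc : t ≤ T - τ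
    · rw [Set.indicator_of_mem (Set.mem_Icc.2 ⟨ht.1.le, hc⟩),
        Set.indicator_of_mem (show T - t ∈ Set.Ici τ from Set.mem_Ici.2 (by linarith)),
        sub_sub_cancel, sub_sub]
    · rw [Set.indicator_of_notMem (fun hx => hc hx.2),
        Set.indicator_of_notMem (fun hx => hc (by linarith [Set.mem_Ici.1 hx]))]

section Integrability

theorem intervalIntegrable_inner {E : Type*} [NormedAddCommGroup E] [InnerProductSpace ℝ E]
    {a b : ℝ} {v X : ℝ → E} (hv : Continuous v)
    (hX : IntervalIntegrable X MeasureTheory.volume a b) :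
    IntervalIntegrable (fun t => inner ℝ (v t) (X t)) MeasureTheory.volume a b := by
  obtain ⟨C, hC⟩ := (isCompact_uIcc (a := a) (b := b)).exists_bound_of_continuousOn
    hv.continuousOn
  rw [intervalIntegrable_iff] at hX ⊢
  refine (hX.norm.const_mul C).mono' (hv.aestronglyMeasurable.inner hX.aestronglyMeasurable) ?_
  refine (MeasureTheory.ae_restrict_iff' measurableSet_uIoc).2 (.of_forall fun t ht => ?_)
  exact (norm_inner_le_norm _ _).trans
    (mul_le_mul_of_nonneg_right (hC t (Set.uIoc_subset_uIcc ht)) (norm_nonneg _))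

theorem intervalIntegrable_glue_sub {ψ u : ℝ → Vec n} (hψ : Continuous ψ) (hu : Continuous u)
    (s τ a b : ℝ) :
    IntervalIntegrable (fun t => glue ψ s u (t - τ)) MeasureTheory.volume a b := by
  have hc : Continuous fun t => ‖ψ (t - τ)‖ + ‖u (t - τ)‖ := by fun_prop
  refine (hc.intervalIntegrable a b).mono_fun'
    ((measurable_glue hψ hu).comp (measurable_id.sub_const τ)).aestronglyMeasurable
    (.of_forall fun t => ?_)
  rcases lt_or_ge (t - τ) s with h | h
  · simp only [glue_of_lt h]
    linarith [norm_nonneg (u (t - τ))]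
  · simp only [glue_of_le h]
    linarith [norm_nonneg (ψ (t - τ))]

theorem IsTrajectory.intervalIntegrable_rhs {τ s B : ℝ} {w : Vec p} {ψ v : ℝ → Vec n} {ξ : Vec n}
    (hf : IsC1 f) (hψ : Continuous ψ) (hτ : 0 ≤ τ) (hsB : s ≤ B)
    (hv : IsTrajectory f τ w s B ψ ξ v) :
    IntervalIntegrable (fun t => f (v t) (v (t - τ)) t w) MeasureTheory.volume s B := by
  obtain ⟨R, hR, hb⟩ := hv.exists_bound hψ (s - τ)
  obtain ⟨K, hK⟩ := exists_isVolterra_clampedRHS hf s B hR w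
  refine ((hK τ ψ hτ hψ).intervalIntegrable hsB hv.continuousOn).congr ?_
  rw [Set.uIoc_of_le hsB]
  exact fun r hr => hv.clampedRHS_eq hR hτ hb ⟨hr.1.le, hr.2⟩

/-- Both sides are integrals over the whole line, related by the translation by `τ`. The part of
`[s, T]` that the translate misses lies below `s + τ`, where `k` vanishes. -/
theorem integral_indicator_comp_add {k : ℝ → ℝ} {s T τ : ℝ} (hs : 0 ≤ s) (hτ : 0 < τ)
    (hsT : s ≤ T) (hk : ∀ t < s + τ, k t = 0) :
    ∫ t in s..T, (Set.Icc 0 (T - τ)).indicator (fun r => k (r + τ)) t = ∫ t in s..T, k t := by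
  rw [intervalIntegral.integral_of_le hsT, intervalIntegral.integral_of_le hsT,
    ← MeasureTheory.integral_Icc_eq_integral_Ioc, ← MeasureTheory.integral_Icc_eq_integral_Ioc,
    ← MeasureTheory.integral_indicator measurableSet_Icc,
    ← MeasureTheory.integral_indicator measurableSet_Icc,
    ← MeasureTheory.integral_add_right_eq_self ((Set.Icc s T).indicator k) τ]
  congr 1
  funext t
  simp only [Set.indicator_apply, Set.mem_Icc]
  by_cases h1 : s ≤ t
  · by_cases h2 : t + τ ≤ T
    · rw [if_pos ⟨h1, by linarith⟩, if_pos ⟨by linarith, by linarith⟩,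
        if_pos ⟨by linarith, h2⟩]
    · rw [if_neg (fun h : s ≤ t + τ ∧ t + τ ≤ T => h2 h.2),
        if_neg (fun h : 0 ≤ t ∧ t ≤ T - τ => h2 (by linarith [h.2])), ite_self]
  · rw [if_neg (fun h : s ≤ t ∧ t ≤ T => h1 h.1), hk _ (by linarith), ite_self]

end Integrability

/-- Pairing the adjoint with the difference of two trajectories that have the same history. -/
theorem IsAdjoint.inner_sub_inner {L : Vec n → ℝ} {τ τ' s T : ℝ} {w w' : Vec p}
    {h lam u : ℝ → Vec n} {ξ : Vec n} (hf : IsC1 f) (hh : Continuous h) (hτ : 0 < τ)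
    (hτ' : 0 < τ') (hs : 0 ≤ s) (hsT : s ≤ T) (htr : IsTrajectory f τ w s T h (h s) h)
    (hlc : Continuous lam) (hlam : IsAdjoint L f τ w T h lam) (huc : Continuous u)
    (hu : IsTrajectory f τ' w' s T h ξ (glue h s u)) :
    IntervalIntegrable (fun t => inner ℝ (lam t) (f (u t) (glue h s u (t - τ')) t w'
          - f (h t) (h (t - τ)) t w - dState f (h t) (h (t - τ)) t w (u t - h t)
          - dDelay f (h t) (h (t - τ)) t w (glue h s u (t - τ) - h (t - τ))))
        MeasureTheory.volume s T ∧
    inner ℝ (lam T) (u T - h T) - inner ℝ (lam s) (ξ - h s)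
      = ∫ t in s..T, inner ℝ (lam t) (f (u t) (glue h s u (t - τ')) t w'
          - f (h t) (h (t - τ)) t w - dState f (h t) (h (t - τ)) t w (u t - h t)
          - dDelay f (h t) (h (t - τ)) t w (glue h s u (t - τ) - h (t - τ))) := by
  have hhs : Continuous fun r => h (r - τ) := hh.comp (continuous_id.sub continuous_const)
  set a : ℝ → Vec n →L[ℝ] Vec n := fun t => dState f (h t) (h (t - τ)) t w
  set b : ℝ → Vec n →L[ℝ] Vec n := fun t => dDelay f (h t) (h (t - τ)) t w
  have ha : Continuous a := hf.continuous_dState hh hhs continuous_id continuous_const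
  have hb : Continuous b := hf.continuous_dDelay hh hhs continuous_id continuous_const
  set X : ℝ → Vec n := fun t => f (h t) (h (t - τ)) t w
  set X' : ℝ → Vec n := fun t => f (u t) (glue h s u (t - τ')) t w'
  have hX : Continuous X :=
    hf.continuous.comp (hh.prodMk (hhs.prodMk (continuous_id.prodMk continuous_const)))
  have hX' : ∀ t, t ≠ s + τ' → ContinuousAt X' t := by
    intro t ht
    have h2 : ContinuousAt (fun t => glue h s u (t - τ')) t :=
      ContinuousAt.comp (f := fun t => t - τ') (g := glue h s u)
        (continuousAt_glue hh huc fun hts => ht (by linarith))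
        (continuous_id.sub continuous_const).continuousAt
    exact hf.continuous.continuousAt.comp
      (huc.continuousAt.prodMk (h2.prodMk (continuousAt_id.prodMk continuousAt_const)))
  have hX'i : IntervalIntegrable X' MeasureTheory.volume s T := by
    refine (hu.intervalIntegrable_rhs hf hh hτ'.le hsT).congr ?_
    rw [Set.uIoc_of_le hsT]
    intro t ht
    simp only [X', glue_of_le (ψ := h) (u := u) ht.1.le]
  set k : ℝ → ℝ := fun t => inner ℝ (lam t) (b t (glue h s u (t - τ) - h (t - τ))) with hk
  have hki : IntervalIntegrable k MeasureTheory.volume s T := by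
    have := intervalIntegrable_inner (continuous_transposeMul hlc hb)
      ((intervalIntegrable_glue_sub hh huc s τ s T).sub (hhs.intervalIntegrable s T))
    simpa only [inner_transposeMul] using this
  set κ : ℝ → Vec n := (Set.Icc 0 (T - τ)).indicator
    (fun r => transposeMul (lam (r + τ)) (dDelay f (h (r + τ)) (h r) (r + τ) w)) with hκ
  have hκc : Continuous fun r => transposeMul (lam (r + τ))
      (dDelay f (h (r + τ)) (h r) (r + τ) w) :=
    continuous_transposeMul (hlc.comp (continuous_id.add continuous_const))
      (hf.continuous_dDelay (hh.comp (continuous_id.add continuous_const)) hh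
        (continuous_id.add continuous_const) continuous_const)
  have hκat : ∀ t, 0 < t → t ≠ T - τ → ContinuousAt κ t := by
    intro t ht htT
    rcases htT.lt_or_gt with h1 | h1
    · refine hκc.continuousAt.congr ?_
      filter_upwards [Icc_mem_nhds ht h1] with x hx
      exact (Set.indicator_of_mem hx (fun r => transposeMul (lam (r + τ))
        (dDelay f (h (r + τ)) (h r) (r + τ) w))).symm
    · refine (continuousAt_const : ContinuousAt (fun _ => (0 : Vec n)) t).congr ?_
      filter_upwards [Ioi_mem_nhds h1] with x hx
      exact (Set.indicator_of_notMem (fun hx' => not_lt.2 hx'.2 hx) _).symm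
  have hκi : IntervalIntegrable κ MeasureTheory.volume s T := by
    rw [intervalIntegrable_iff]
    exact (intervalIntegrable_iff.1 (hκc.intervalIntegrable s T)).indicator measurableSet_Icc
  have hlamd : ∀ t ∈ Set.Ioo s T, t ≠ T - τ →
      HasDerivAt lam (-transposeMul (lam t) (a t) - κ t) t := by
    intro t ht htT
    exact hasDerivAt_of_deriv_left (g := fun t => -transposeMul (lam t) (a t) - κ t)
      (a := 0) (b := T) ⟨hs.trans_lt ht.1, ht.2⟩ hlc.continuousOn
      (fun r hr => hlam.deriv_left r ⟨hr.1, hr.2.le⟩)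
      ((continuous_transposeMul hlc ha).continuousAt.neg.sub
        (hκat t (hs.trans_lt ht.1) htT))
  have hhd : ∀ t ∈ Set.Ioo s T, HasDerivAt h (X t) t := fun t ht =>
    hasDerivAt_of_deriv_right ht hh.continuousOn
      (fun r hr => htr.deriv_right r ⟨hr.1.le, hr.2⟩) hX.continuousAt
  have hud : ∀ t ∈ Set.Ioo s T, t ≠ s + τ' → HasDerivAt u (X' t) t := by
    intro t ht htτ
    refine hasDerivAt_of_deriv_right ht huc.continuousOn (fun r hr => ?_) (hX' t htτ)
    have := hu.deriv_right r ⟨hr.1.le, hr.2⟩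
    rw [glue_of_le hr.1.le] at this
    exact this.congr (fun x hx => (glue_of_le (le_trans hr.1.le hx)).symm)
      (glue_of_le hr.1.le).symm
  have hei : Continuous fun t => u t - h t := huc.sub hh
  have hIi : IntervalIntegrable
      (fun t => inner ℝ (lam t) (X' t - X t) + inner ℝ (-transposeMul (lam t) (a t) - κ t)
        (u t - h t)) MeasureTheory.volume s T := by
    refine (intervalIntegrable_inner hlc (hX'i.sub (hX.intervalIntegrable s T))).add ?_
    have := intervalIntegrable_inner hei
      (((continuous_transposeMul hlc ha).neg.intervalIntegrable s T).sub hκi)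
    simpa only [real_inner_comm, Pi.neg_apply] using this
  -- The pairing is continuous, and differentiable except possibly at `s + τ'`, where the equation
  -- of `u` may jump, and `T - τ`, where that of `lam` may jump.
  have hFTC := MeasureTheory.integral_eq_of_hasDerivAt_off_countable_of_le
    (fun t => inner ℝ (lam t) (u t - h t))
    (fun t => inner ℝ (lam t) (X' t - X t) + inner ℝ (-transposeMul (lam t) (a t) - κ t)
      (u t - h t)) hsT (s := {s + τ', T - τ}) (Set.toFinite _).countable
    (hlc.inner hei).continuousOn
    (fun t ht => by
      have h1 : t ≠ s + τ' := fun h1 => ht.2 (Or.inl h1)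
      have h2 : t ≠ T - τ := fun h1 => ht.2 (Or.inr h1)
      exact (hlamd t ht.1 h2).inner ℝ ((hud t ht.1 h1).sub (hhd t ht.1))) hIi
  have hus : u s = ξ := by rw [← hu.start, glue_of_le le_rfl]
  -- The advanced term of the adjoint equation becomes the delayed term of the linearised equation;
  -- `k` vanishes before `s + τ` because both trajectories have the history `h` there.
  have hshift : ∫ t in s..T, inner ℝ (κ t) (u t - h t) = ∫ t in s..T, k t := by
    rw [← integral_indicator_comp_add hs hτ hsT (k := k) (fun t ht => by
      simp only [hk]
      rw [glue_of_lt (by linarith), sub_self, map_zero, inner_zero_right])]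
    refine intervalIntegral.integral_congr fun t ht => ?_
    rw [Set.uIcc_of_le hsT] at ht
    simp only [hκ, hk]
    by_cases hmem : t ∈ Set.Icc 0 (T - τ)
    · rw [Set.indicator_of_mem hmem, Set.indicator_of_mem hmem, inner_transposeMul]
      simp only [b, add_sub_cancel_right]
      rw [glue_of_le ht.1]
    · rw [Set.indicator_of_notMem hmem, Set.indicator_of_notMem hmem, inner_zero_left]
  have hκe : IntervalIntegrable (fun t => inner ℝ (κ t) (u t - h t)) MeasureTheory.volume s T := by
    have := intervalIntegrable_inner hei hκi
    simpa only [real_inner_comm] using this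
  have hmain : IntervalIntegrable (fun t => inner ℝ (lam t) (X' t - X t - a t (u t - h t)))
      MeasureTheory.volume s T :=
    intervalIntegrable_inner hlc ((hX'i.sub (hX.intervalIntegrable s T)).sub
      ((ha.clm_apply hei).intervalIntegrable s T))
  have e1 : ∀ t, inner ℝ (lam t) (X' t - X t) + inner ℝ (-transposeMul (lam t) (a t) - κ t)
      (u t - h t) = inner ℝ (lam t) (X' t - X t - a t (u t - h t))
        - inner ℝ (κ t) (u t - h t) := by
    intro t
    rw [inner_sub_left, inner_neg_left, inner_transposeMul, inner_sub_right (lam t) (X' t - X t)]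
    ring
  have e2 : ∀ t, inner ℝ (lam t) (X' t - X t - a t (u t - h t)
      - b t (glue h s u (t - τ) - h (t - τ)))
      = inner ℝ (lam t) (X' t - X t - a t (u t - h t)) - k t := fun t => inner_sub_right _ _ _
  refine ⟨(hmain.sub hki).congr fun t _ => (e2 t).symm, ?_⟩
  rw [hus] at hFTC
  rw [← hFTC]
  rw [intervalIntegral.integral_congr (fun t _ => e1 t),
    intervalIntegral.integral_congr (fun t _ => e2 t), intervalIntegral.integral_sub hmain hκe, intervalIntegral.integral_sub hmain hki, hshift]

end NDDE

/-! ### Expansion of the loss; gradients in the state and the parameters. -/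

namespace NDDE

variable {n p : ℕ} {f : Field n p}

/-- First-order expansion of the loss in the parameters, the delay and the starting state. -/
theorem IsAdjoint.exists_expansion {L : Vec n → ℝ} {τ s T : ℝ} {w : Vec p}
    {h lam : ℝ → Vec n} (hf : IsC1 f) (hh : Continuous h) (hτ : 0 < τ)
    (hs : 0 ≤ s) (hsT : s ≤ T) (htr : IsTrajectory f τ w s T h (h s) h)
    (hlc : Continuous lam) (hlam : IsAdjoint L f τ w T h lam) (hL : DifferentiableAt ℝ L (h T)) :
    ∃ C, 0 ≤ C ∧ ∀ ε > 0, ∃ δ > 0, ∀ (w' : Vec p) (τ' : ℝ) (ξ : Vec n) (ω : ℝ), 0 < τ' →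
      τ' ≤ τ + 1 → ‖w' - w‖ ≤ δ → ‖ξ - h s‖ ≤ δ → 0 ≤ ω → ω ≤ δ →
      (∀ r ∈ Set.Icc s T, ‖h (r - τ') - h (r - τ)‖ ≤ ω) →
      ∃ u : ℝ → Vec n, Continuous u ∧ IsTrajectory f τ' w' s T h ξ (glue h s u) ∧
        (∀ t ∈ Set.Icc s T,
          ‖f (u t) (glue h s u (t - τ')) t w' - f (h t) (h (t - τ)) t w‖
            ≤ C * (‖ξ - h s‖ + ‖w' - w‖ + ω)) ∧
        |loss L f τ' w' s T h ξ - L (h T) - inner ℝ (lam s) (ξ - h s)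
          - (∫ t in s..T, inner ℝ (lam t) (dParam f (h t) (h (t - τ)) t w (w' - w)))
          - ∫ t in s..T, inner ℝ (lam t) (dDelay f (h t) (h (t - τ)) t w
              (glue h s u (t - τ') - glue h s u (t - τ)))|
          ≤ ε * (‖ξ - h s‖ + ‖w' - w‖ + ω) := by
  obtain ⟨C, hC, δ₀, hδ₀, hpert⟩ := htr.exists_perturbation hf hh hτ hsT
  refine ⟨C, hC, fun ε hε => ?_⟩
  obtain ⟨M, hM⟩ := (isCompact_Icc (a := s) (b := T)).exists_bound_of_continuousOn
    hlc.continuousOn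
  have hM0 : 0 ≤ M := (norm_nonneg _).trans (hM s ⟨le_rfl, hsT⟩)
  have hTs : 0 ≤ T - s := sub_nonneg.2 hsT
  have hhs : Continuous fun r => h (r - τ) := hh.comp (continuous_id.sub continuous_const)
  -- Half of `ε` goes to the Taylor remainder of `f`, weighted by the bound `M` of `lam` and the
  -- length `T - s`, and half to that of `L`.
  have hε₁ : 0 < ε / (2 * (C + 1) * (M * (T - s) + 1)) := by positivity
  have hε₂ : 0 < ε / (2 * (C + 1)) := by positivity
  obtain ⟨δ₁, hδ₁, hexp⟩ := hf.exists_uniform_expansion (a := s) (b := T)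
    (c := fun t => (h t, h (t - τ), w)) (hh.prodMk (hhs.prodMk continuous_const)) hε₁
  obtain ⟨δ₂, hδ₂, hLexp⟩ := Metric.eventually_nhds_iff_ball.1
    (Asymptotics.isLittleO_iff.1 (hasGradientAt_iff_isLittleO.1 hL.hasGradientAt) hε₂)
  have hδ₃ : 0 < min δ₁ (δ₂ / 2) / (3 * (C + 1)) := by positivity
  refine ⟨min δ₀ (min δ₁ (δ₂ / 2) / (3 * (C + 1))), lt_min hδ₀ hδ₃,
    fun w' τ' ξ ω hτ' hτ'1 hw hξ hω0 hω hωr => ?_⟩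
  obtain ⟨u, huc, hu, huh, hug, huf⟩ := hpert w' τ' ξ ω hτ' hτ'1 (hw.trans (min_le_left _ _))
    (hξ.trans (min_le_left _ _)) hω0 (hω.trans (min_le_left _ _)) hωr
  refine ⟨u, huc, hu, huf, ?_⟩
  set η := ‖ξ - h s‖ + ‖w' - w‖ + ω with hη
  have hη0 : 0 ≤ η := by positivity
  have hη' : (C + 1) * η ≤ min δ₁ (δ₂ / 2) := by
    have h1 : η ≤ 3 * (min δ₁ (δ₂ / 2) / (3 * (C + 1))) := by
      linarith [hw.trans (min_le_right _ _), hξ.trans (min_le_right _ _),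
        hω.trans (min_le_right _ _)]
    calc (C + 1) * η ≤ (C + 1) * (3 * (min δ₁ (δ₂ / 2) / (3 * (C + 1)))) := by gcongr
      _ = min δ₁ (δ₂ / 2) := by field_simp
  have hCη : C * η ≤ (C + 1) * η := by linarith
  rw [loss_eq L hf hh hτ'.le hsT hu, glue_of_le hsT]
  obtain ⟨hdi, hdual⟩ := hlam.inner_sub_inner hf hh hτ hτ' hs hsT htr hlc huc hu
  set I₁ := ∫ t in s..T, inner ℝ (lam t) (dParam f (h t) (h (t - τ)) t w (w' - w))
  set I₂ := ∫ t in s..T, inner ℝ (lam t) (dDelay f (h t) (h (t - τ)) t w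
              (glue h s u (t - τ') - glue h s u (t - τ)))
  have hi₁ : IntervalIntegrable (fun t => inner ℝ (lam t)
      (dParam f (h t) (h (t - τ)) t w (w' - w))) MeasureTheory.volume s T :=
    (hlc.inner ((hf.continuous_dParam hh hhs continuous_id continuous_const).clm_apply
      continuous_const)).intervalIntegrable _ _
  have hi₂ : IntervalIntegrable (fun t => inner ℝ (lam t) (dDelay f (h t) (h (t - τ)) t w
              (glue h s u (t - τ') - glue h s u (t - τ)))) MeasureTheory.volume s T := by
    have := intervalIntegrable_inner (continuous_transposeMul hlc
        (hf.continuous_dDelay hh hhs continuous_id' (continuous_const (y := w))))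
      ((intervalIntegrable_glue_sub hh huc s τ' s T).sub
        (intervalIntegrable_glue_sub hh huc s τ s T))
    simpa only [inner_transposeMul] using this
  -- The delayed increment `glue h s u (t - τ') - h (t - τ)` is split at `glue h s u (t - τ)`: the
  -- first piece is in `I₂`, the second is already in the duality identity. The integrand that
  -- remains is the Taylor remainder of `f` paired with `lam`.
  have hrem : |inner ℝ (lam T) (u T - h T) - inner ℝ (lam s) (ξ - h s) - I₁ - I₂|
      ≤ ε / 2 * η := by
    rw [hdual, ← intervalIntegral.integral_sub hdi hi₁,
      ← intervalIntegral.integral_sub (hdi.sub hi₁) hi₂, ← Real.norm_eq_abs]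
    refine (intervalIntegral.norm_integral_le_of_norm_le_const
      (C := M * (ε / (2 * (C + 1) * (M * (T - s) + 1)) * ((C + 1) * η)))
      fun t ht => ?_).trans ?_
    · rw [Set.uIoc_of_le hsT] at ht
      have ht' : t ∈ Set.Icc s T := ⟨ht.1.le, ht.2⟩
      rw [← inner_sub_right, ← inner_sub_right]
      refine (norm_inner_le_norm _ _).trans (mul_le_mul (hM t ht') ?_ (norm_nonneg _) hM0)
      have hq : ‖((u t, glue h s u (t - τ'), w') : Vec n × Vec n × Vec p)
          - (h t, h (t - τ), w)‖ ≤ (C + 1) * η := by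
        rw [norm_prod_le_iff, norm_prod_le_iff]
        refine ⟨(huh t ht').trans hCη, (hug t ht').trans hCη, ?_⟩
        change ‖w' - w‖ ≤ _
        have : 0 ≤ C * η := by positivity
        linarith [norm_nonneg (ξ - h s)]
      have h1 := (hexp t ht' (u t, glue h s u (t - τ'), w')
        (hq.trans (hη'.trans (min_le_left _ _)))).trans
          (mul_le_mul_of_nonneg_left hq hε₁.le)
      rw [hf.fderiv_apply] at h1
      refine le_trans (le_of_eq ?_) h1
      congr 1
      simp only [Prod.fst_sub, Prod.snd_sub, map_sub]
      abel
    · rw [abs_of_nonneg hTs]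
      have h1 : M * (T - s) / (M * (T - s) + 1) ≤ 1 :=
        (div_le_one (by positivity)).2 (by linarith)
      calc M * (ε / (2 * (C + 1) * (M * (T - s) + 1)) * ((C + 1) * η)) * (T - s)
          = M * (T - s) / (M * (T - s) + 1) * (ε / 2 * η) := by field_simp
        _ ≤ 1 * (ε / 2 * η) := by gcongr
        _ = ε / 2 * η := one_mul _
  have hLrem : |L (u T) - L (h T) - inner ℝ (lam T) (u T - h T)| ≤ ε / 2 * η := by
    have hb : ‖u T - h T‖ ≤ (C + 1) * η := (huh T ⟨hsT, le_rfl⟩).trans hCη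
    have h1 := hLexp (u T) (by
      rw [mem_ball_iff_norm]
      exact (hb.trans (hη'.trans (min_le_right _ _))).trans_lt (half_lt_self hδ₂))
    rw [← hlam.terminal, Real.norm_eq_abs] at h1
    refine h1.trans ((mul_le_mul_of_nonneg_left hb hε₂.le).trans (le_of_eq ?_))
    field_simp
  calc _ = |(L (u T) - L (h T) - inner ℝ (lam T) (u T - h T))
        + (inner ℝ (lam T) (u T - h T) - inner ℝ (lam s) (ξ - h s) - I₁ - I₂)| := by
        congr 1; ring
    _ ≤ ε / 2 * η + ε / 2 * η := (abs_add_le _ _).trans (add_le_add hLrem hrem)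
    _ = ε * η := by ring

/-- With parameters and delay unchanged, `ω = 0` is admissible and both integrals in the expansion
vanish. -/
theorem hasGradientAt_loss_state {L : Vec n → ℝ} {τ s T : ℝ} {w : Vec p}
    {h lam : ℝ → Vec n} (hf : IsC1 f) (hh : Continuous h) (hτ : 0 < τ)
    (hs : 0 ≤ s) (hsT : s ≤ T) (htr : IsTrajectory f τ w s T h (h s) h)
    (hlc : Continuous lam) (hlam : IsAdjoint L f τ w T h lam) (hL : DifferentiableAt ℝ L (h T)) :
    HasGradientAt (fun ξ => loss L f τ w s T h ξ) (lam s) (h s) := by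
  obtain ⟨C, -, hexp⟩ := hlam.exists_expansion hf hh hτ hs hsT htr hlc hL
  rw [hasGradientAt_iff_isLittleO, Asymptotics.isLittleO_iff]
  intro ε hε
  obtain ⟨δ, hδ, hδ'⟩ := hexp ε hε
  filter_upwards [Metric.closedBall_mem_nhds (h s) hδ] with ξ hξ
  obtain ⟨u, -, -, -, hu⟩ := hδ' w τ ξ 0 hτ (by linarith) (by simpa using hδ.le)
    (by rwa [← dist_eq_norm]) le_rfl hδ.le (by simp)
  rw [loss_eq L hf hh hτ.le hsT htr]
  simpa using hu

theorem hasGradientAt_loss_param {L : Vec n → ℝ} {τ s T : ℝ} {w : Vec p}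
    {h lam : ℝ → Vec n} (hf : IsC1 f) (hh : Continuous h) (hτ : 0 < τ)
    (hs : 0 ≤ s) (hsT : s ≤ T) (htr : IsTrajectory f τ w s T h (h s) h)
    (hlc : Continuous lam) (hlam : IsAdjoint L f τ w T h lam) (hL : DifferentiableAt ℝ L (h T)) :
    HasGradientAt (fun w' => loss L f τ w' s T h (h s))
      (∫ t in s..T, transposeMul (lam t) (dParam f (h t) (h (t - τ)) t w)) w := by
  have hhs : Continuous fun r => h (r - τ) := hh.comp (continuous_id.sub continuous_const)
  obtain ⟨C, -, hexp⟩ := hlam.exists_expansion hf hh hτ hs hsT htr hlc hL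
  rw [hasGradientAt_iff_isLittleO, Asymptotics.isLittleO_iff]
  intro ε hε
  obtain ⟨δ, hδ, hδ'⟩ := hexp ε hε
  filter_upwards [Metric.closedBall_mem_nhds w hδ] with w' hw'
  obtain ⟨u, -, -, -, hu⟩ := hδ' w' τ (h s) 0 hτ (by linarith) (by rwa [← dist_eq_norm])
    (by simpa using hδ.le) le_rfl hδ.le (by simp)
  have hint : inner ℝ (∫ t in s..T, transposeMul (lam t) (dParam f (h t) (h (t - τ)) t w))
      (w' - w)
      = ∫ t in s..T, inner ℝ (lam t) (dParam f (h t) (h (t - τ)) t w (w' - w)) := by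
    rw [real_inner_comm, ← innerSL_apply_apply ℝ,
      ← ContinuousLinearMap.intervalIntegral_comp_comm _
      ((continuous_transposeMul hlc (hf.continuous_dParam hh hhs continuous_id'
        continuous_const)).intervalIntegrable _ _)]
    refine intervalIntegral.integral_congr fun t _ => ?_
    simp only [innerSL_apply_apply]
    rw [real_inner_comm, inner_transposeMul]
  rw [loss_eq L hf hh hτ.le hsT htr, hint]
  simpa using hu

end NDDE

/-! ### Local well-posedness; derivatives in the final time and the delay. -/

namespace NDDE

variable {n p : ℕ} {f : Field n p}

theorem norm_sub_le_of_deriv_right {E : Type*} [NormedAddCommGroup E] [NormedSpace ℝ E]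
    {e g : ℝ → E} {a b D : ℝ} (he : ContinuousOn e (Set.Icc a b))
    (hd : ∀ t ∈ Set.Ico a b, HasDerivWithinAt e (g t) (Set.Ici t) t)
    (hg : ∀ t ∈ Set.Ico a b, ‖g t‖ ≤ D) {x y : ℝ} (hx : x ∈ Set.Icc a b)
    (hy : y ∈ Set.Icc a b) : ‖e x - e y‖ ≤ D * |x - y| := by
  have key : ∀ x ∈ Set.Icc a b, ∀ y ∈ Set.Icc a b, x ≤ y → ‖e y - e x‖ ≤ D * (y - x) :=
    fun x hx y hy hxy => norm_image_sub_le_of_norm_deriv_right_le_segment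
      (he.mono (Set.Icc_subset_Icc hx.1 hy.2))
      (fun t ht => hd t ⟨hx.1.trans ht.1, ht.2.trans_le hy.2⟩)
      (fun t ht => hg t ⟨hx.1.trans ht.1, ht.2.trans_le hy.2⟩) y ⟨hxy, le_rfl⟩
  rcases le_total x y with hxy | hxy
  · rw [norm_sub_rev, abs_sub_comm, abs_of_nonneg (sub_nonneg.2 hxy)]
    exact key x hx y hy hxy
  · rw [abs_of_nonneg (sub_nonneg.2 hxy)]
    exact key y hy x hx hxy

namespace IsTrajectory

variable {τ T : ℝ} {w : Vec p} {h : ℝ → Vec n}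

/-- The history is Lipschitz on compact intervals by smoothness, the solution because its right-hand
side is bounded. A kink at `0` is harmless: pairs on opposite sides are compared through `h 0`. -/
theorem exists_lipschitz (hf : IsC1 f) (hh : Continuous h)
    (hT : 0 < T) (htr : IsTrajectory f τ w 0 T h (h 0) h) (hC : ContDiffOn ℝ 1 h (Set.Iic 0))
    (c : ℝ) : ∃ Λ, 0 ≤ Λ ∧ ∀ x ∈ Set.Icc c T, ∀ y ∈ Set.Icc c T, ‖h x - h y‖ ≤ Λ * |x - y| := by
  obtain ⟨K, hK⟩ := (hC.mono Set.Icc_subset_Iic_self).exists_lipschitzOnWith (s := Set.Icc c 0)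
    one_ne_zero (convex_Icc _ _) isCompact_Icc
  have hX : Continuous fun t => f (h t) (h (t - τ)) t w :=
    hf.continuous.comp (hh.prodMk ((hh.comp (continuous_id.sub continuous_const)).prodMk
      (continuous_id.prodMk continuous_const)))
  obtain ⟨D, hD⟩ := (isCompact_Icc (a := 0) (b := T)).exists_bound_of_continuousOn hX.continuousOn
  have hD0 : 0 ≤ D := (norm_nonneg _).trans (hD 0 ⟨le_rfl, hT.le⟩)
  have e1 : ∀ x ∈ Set.Icc c 0, ∀ y ∈ Set.Icc c 0, ‖h x - h y‖ ≤ (K + D) * |x - y| := by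
    intro x hx y hy
    have h1 := hK.dist_le_mul x hx y hy
    rw [dist_eq_norm, Real.dist_eq] at h1
    have := mul_nonneg hD0 (abs_nonneg (x - y))
    linarith
  have e2 : ∀ x ∈ Set.Icc 0 T, ∀ y ∈ Set.Icc 0 T, ‖h x - h y‖ ≤ (K + D) * |x - y| := by
    intro x hx y hy
    have h1 := norm_sub_le_of_deriv_right hh.continuousOn htr.deriv_right
      (fun t ht => hD t ⟨ht.1, ht.2.le⟩) hx hy
    have := mul_nonneg K.coe_nonneg (abs_nonneg (x - y))
    linarith
  have e3 : ∀ x ∈ Set.Icc c 0, ∀ y ∈ Set.Icc 0 T, ‖h x - h y‖ ≤ (K + D) * |x - y| := by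
    intro x hx y hy
    have h1 := e1 x hx 0 ⟨hx.1.trans hx.2, le_rfl⟩
    have h2 := e2 0 ⟨le_rfl, hT.le⟩ y hy
    rw [abs_of_nonpos (by linarith [hx.2])] at h1
    rw [abs_of_nonpos (by linarith [hy.1])] at h2
    rw [abs_of_nonpos (by linarith [hx.2, hy.1])]
    have := norm_sub_le_norm_sub_add_norm_sub (h x) (h 0) (h y)
    linarith
  refine ⟨K + D, by positivity, fun x hx y hy => ?_⟩
  rcases le_total x 0 with h1 | h1 <;> rcases le_total y 0 with h2 | h2
  · exact e1 x ⟨hx.1, h1⟩ y ⟨hy.1, h2⟩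
  · exact e3 x ⟨hx.1, h1⟩ y ⟨h2, hy.2⟩
  · rw [norm_sub_rev, abs_sub_comm]
    exact e3 y ⟨hy.1, h2⟩ x ⟨h1, hx.2⟩
  · exact e2 x ⟨h1, hx.2⟩ y ⟨h2, hy.2⟩

theorem hasDerivAt_of_mem_Ioo {s B : ℝ} {ξ : Vec n} {ψ : ℝ → Vec n} (hf : IsC1 f)
    (hh : Continuous h) (htr : IsTrajectory f τ w s B ψ ξ h) {t : ℝ} (ht : t ∈ Set.Ioo s B) :
    HasDerivAt h (f (h t) (h (t - τ)) t w) t := by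
  have hX : Continuous fun t => f (h t) (h (t - τ)) t w :=
    hf.continuous.comp (hh.prodMk ((hh.comp (continuous_id.sub continuous_const)).prodMk
      (continuous_id.prodMk continuous_const)))
  exact hasDerivAt_of_deriv_right (g := fun t => f (h t) (h (t - τ)) t w) ht hh.continuousOn
    (fun r hr => htr.deriv_right r ⟨hr.1.le, hr.2⟩) hX.continuousAt

/-- The output exists and is unique for all data near those of a given trajectory. -/
theorem eventually_existsUnique_isOutput (hf : IsC1 f) (hh : Continuous h) (hτ : 0 < τ)
    (hT : 0 < T) (htr : IsTrajectory f τ w 0 T h (h 0) h) :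
    ∀ᶠ q : Vec p × ℝ × ℝ × Vec n in 𝓝 (w, τ, T, h 0),
      ∃! x, IsOutput f q.2.1 q.1 0 q.2.2.1 h q.2.2.2 x := by
  -- Final times beyond `T` are covered by perturbing the continued trajectory on `[0, T + ε]` and
  -- restricting the result.
  obtain ⟨ε, hε, g, hg, hgtr, hgh⟩ := htr.exists_extension hf hh hτ hT.le
  obtain ⟨C, hC, δ, hδ, hpert⟩ := hgtr.exists_perturbation hf hg hτ (by linarith)
  have huc := (isCompact_Icc (a := -τ) (b := T + ε)).uniformContinuousAt_of_continuousAt g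
    (fun x _ => hg.continuousAt) (Metric.dist_mem_uniformity hδ)
  obtain ⟨δ', hδ', hgδ⟩ := Metric.mem_uniformity_dist.1 huc
  have h1 : ∀ᶠ w' in 𝓝 w, ‖w' - w‖ ≤ δ := by
    filter_upwards [Metric.closedBall_mem_nhds w hδ] with w' hw'
    rwa [← dist_eq_norm]
  have h2 : ∀ᶠ τ' in 𝓝 τ, (0 < τ' ∧ τ' < τ + 1) ∧ |τ' - τ| < δ' := by
    filter_upwards [Ioo_mem_nhds hτ (by linarith : τ < τ + 1), Metric.ball_mem_nhds τ hδ']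
      with τ' h1 h2 using ⟨h1, h2⟩
  have h3 : ∀ᶠ T' in 𝓝 T, 0 < T' ∧ T' < T + ε := Ioo_mem_nhds hT (by linarith)
  have h4 : ∀ᶠ ξ in 𝓝 (h 0), ‖ξ - h 0‖ ≤ δ := by
    filter_upwards [Metric.closedBall_mem_nhds (h 0) hδ] with ξ hξ
    rwa [← dist_eq_norm]
  have hall := h1.prod_nhds (h2.prod_nhds (h3.prod_nhds h4))
  filter_upwards [hall] with q hq
  obtain ⟨hq1, ⟨⟨hq2, hq3⟩, hq4⟩, ⟨hq5, hq6⟩, hq7⟩ := hq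
  -- Only solvability matters here, so `ω` is the largest admissible value `δ`; uniform continuity
  -- of `g` guarantees it for delays close to `τ`.
  obtain ⟨u, -, hu, -⟩ := hpert q.1 q.2.1 q.2.2.2 δ hq2 hq3.le hq1
    (by rwa [hgh 0 hT.le]) hδ.le le_rfl (fun r hr => by
      have hd : dist (r - τ) (r - q.2.1) < δ' := by
        rw [Real.dist_eq]
        convert hq4 using 2
        ring
      have := hgδ hd ⟨by linarith [hr.1], by linarith [hr.2]⟩
      rw [← dist_eq_norm, dist_comm]
      exact le_of_lt this)
  exact existsUnique_isOutput hf hh hq2.le hq5.le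
    ((hu.mono hq6.le).congr_history fun t ht => hgh t (by linarith))

theorem eventually_existsUnique_isOutput_state {s : ℝ} (hf : IsC1 f) (hh : Continuous h)
    (hτ : 0 < τ) (hsT : s ≤ T) (htr : IsTrajectory f τ w s T h (h s) h) :
    ∀ᶠ ξ in 𝓝 (h s), ∃! x, IsOutput f τ w s T h ξ x := by
  obtain ⟨C, hC, δ, hδ, hpert⟩ := htr.exists_perturbation hf hh hτ hsT
  filter_upwards [Metric.closedBall_mem_nhds (h s) hδ] with ξ hξ
  obtain ⟨u, -, hu, -⟩ := hpert w τ ξ 0 hτ (by linarith) (by simpa using hδ.le)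
    (by rwa [← dist_eq_norm]) le_rfl hδ.le (by simp)
  exact existsUnique_isOutput hf hh hτ.le hsT hu

end IsTrajectory

/-- By uniqueness the loss near `T` is `L` along one continued trajectory `g`, which is
differentiable at `T` because `T` is now an interior time. -/
theorem hasDerivAt_loss_time {L : Vec n → ℝ} {τ T : ℝ} {w : Vec p} {h : ℝ → Vec n} (hf : IsC1 f)
    (hh : Continuous h) (hτ : 0 < τ) (hT : 0 < T) (htr : IsTrajectory f τ w 0 T h (h 0) h)
    (hL : DifferentiableAt ℝ L (h T)) :
    HasDerivAt (fun T' => loss L f τ w 0 T' h (h 0))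
      (inner ℝ (gradient L (h T)) (f (h T) (h (T - τ)) T w)) T := by
  obtain ⟨ε, hε, g, hg, hgtr, hgh⟩ := htr.exists_extension hf hh hτ hT.le
  have hgT := hgtr.hasDerivAt_of_mem_Ioo hf hg (t := T) ⟨hT, by linarith⟩
  rw [hgh T le_rfl, hgh (T - τ) (by linarith)] at hgT
  have hL' : HasGradientAt L (gradient L (h T)) (g T) := by
    rw [hgh T le_rfl]
    exact hL.hasGradientAt
  have hd := hL'.hasFDerivAt.comp_hasDerivAt T hgT
  rw [InnerProductSpace.toDual_apply_apply] at hd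
  refine hd.congr_of_eventuallyEq ?_
  filter_upwards [Ioo_mem_nhds hT (by linarith : T < T + ε)] with T' hT'
  have htr' := (hgtr.mono hT'.2.le).congr_history (ψ' := h) fun t ht => hgh t (by linarith)
  rw [hgh 0 hT.le] at htr'
  exact loss_eq L hf hh hτ.le hT'.1.le htr'

/-- Differentiation of a delayed function under the integral, with respect to the delay. -/
theorem hasDerivAt_integral_delay {τ T Λ : ℝ} {h v : ℝ → Vec n} (hh : Continuous h)
    (hv : Continuous v) (hτ : 0 < τ) (hT : 0 < T)
    (hΛ : ∀ x ∈ Set.Icc (-(τ + 1)) T, ∀ y ∈ Set.Icc (-(τ + 1)) T, ‖h x - h y‖ ≤ Λ * |x - y|)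
    (hd : ∀ t < T, t ≠ 0 → DifferentiableAt ℝ h t) :
    HasDerivAt (fun τ' => ∫ t in (0 : ℝ)..T, inner ℝ (v t) (h (t - τ')))
      (∫ t in (0 : ℝ)..T, inner ℝ (v t) (-deriv h (t - τ))) τ := by
  have hΛ0 : 0 ≤ Λ := by
    have h1 := (norm_nonneg _).trans (hΛ 0 ⟨by linarith, hT.le⟩ T ⟨by linarith, le_rfl⟩)
    exact nonneg_of_mul_nonneg_left h1 (abs_pos.2 (by linarith))
  refine (intervalIntegral.hasDerivAt_integral_of_dominated_loc_of_lip
    (bound := fun t => ‖v t‖ * Λ) (s := Set.Icc 0 (τ + 1))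
    (Icc_mem_nhds hτ (by linarith)) (.of_forall fun τ' => ?_) ?_ ?_ ?_ ?_ ?_).2
  · exact (hv.inner (hh.comp (continuous_id.sub continuous_const))).aestronglyMeasurable
  · exact (hv.inner (hh.comp (continuous_id.sub continuous_const))).intervalIntegrable _ _
  · exact hv.aestronglyMeasurable.inner
      ((measurable_deriv h).comp (measurable_id.sub_const τ)).neg.aestronglyMeasurable
  · refine .of_forall fun t ht => LipschitzOnWith.of_dist_le_mul fun x hx y hy => ?_
    rw [Set.uIoc_of_le hT.le] at ht
    rw [Real.coe_nnabs, abs_of_nonneg (by positivity), Real.dist_eq, Real.dist_eq,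
      ← inner_sub_right]
    refine (abs_real_inner_le_norm _ _).trans ?_
    rw [mul_assoc]
    refine mul_le_mul_of_nonneg_left ((hΛ _ ?_ _ ?_).trans (le_of_eq ?_)) (norm_nonneg _)
    · exact ⟨by linarith [ht.1, hx.2], by linarith [ht.2, hx.1]⟩
    · exact ⟨by linarith [ht.1, hy.2], by linarith [ht.2, hy.1]⟩
    · rw [abs_sub_comm x y]
      congr 2
      ring
  · exact (hv.norm.mul continuous_const).intervalIntegrable _ _
  · have hne : ∀ᵐ t : ℝ ∂MeasureTheory.volume, t ≠ τ :=
      MeasureTheory.Measure.ae_ne MeasureTheory.volume τ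
    filter_upwards [hne] with t htτ ht
    rw [Set.uIoc_of_le hT.le] at ht
    have h1 := (hd (t - τ) (by linarith [ht.2]) (sub_ne_zero.2 htτ)).hasDerivAt
    have h2 : HasDerivAt (fun τ' => h (t - τ')) (-deriv h (t - τ)) τ := by
      have h3 := HasDerivAt.scomp τ h1 ((hasDerivAt_id τ).const_sub t)
      rw [neg_one_smul] at h3
      exact h3
    simpa using (hasDerivAt_const τ (v t)).inner ℝ h2

/-- The expansion leaves the increment of the perturbed trajectory between `t - τ` and `t - τ'`.
Replacing that trajectory by `h` costs the increment of `e = u - h`, whose Lipschitz constant is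
itself `O(|τ' - τ|)` since the two right-hand sides are that close. The error `J` is thus quadratic,
and the rest is `hasDerivAt_integral_delay`. -/
theorem hasDerivAt_loss_delay {L : Vec n → ℝ} {τ T : ℝ} {w : Vec p}
    {h lam : ℝ → Vec n} (hf : IsC1 f) (hh : Continuous h) (hτ : 0 < τ)
    (hT : 0 < T) (htr : IsTrajectory f τ w 0 T h (h 0) h) (hC : ContDiffOn ℝ 1 h (Set.Iic 0))
    (hlc : Continuous lam) (hlam : IsAdjoint L f τ w T h lam) (hL : DifferentiableAt ℝ L (h T)) :
    HasDerivAt (fun τ' => loss L f τ' w 0 T h (h 0))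
      (∫ t in (0 : ℝ)..T,
        -inner ℝ (lam t) (dDelay f (h t) (h (t - τ)) t w (deriv h (t - τ)))) τ := by
  have hhs : ∀ c, Continuous fun r => h (r - c) := fun c =>
    hh.comp (continuous_id.sub continuous_const)
  set v : ℝ → Vec n := fun t => transposeMul (lam t) (dDelay f (h t) (h (t - τ)) t w)
  have hv : Continuous v := continuous_transposeMul hlc
    (hf.continuous_dDelay hh (hhs τ) continuous_id continuous_const)
  obtain ⟨V, hV⟩ := (isCompact_Icc (a := 0) (b := T)).exists_bound_of_continuousOn hv.continuousOn
  have hV0 : 0 ≤ V := (norm_nonneg _).trans (hV 0 ⟨le_rfl, hT.le⟩)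
  obtain ⟨Λ, hΛ0, hΛ⟩ := htr.exists_lipschitz hf hh hT hC (-(τ + 1))
  have hdiff : ∀ t < T, t ≠ 0 → DifferentiableAt ℝ h t := by
    intro t ht ht0
    rcases ht0.lt_or_gt with h1 | h1
    · exact (hC.contDiffAt (Iic_mem_nhds h1)).differentiableAt one_ne_zero
    · exact (htr.hasDerivAt_of_mem_Ioo hf hh ⟨h1, ht⟩).differentiableAt
  have hF := hasDerivAt_integral_delay hh hv hτ hT hΛ hdiff
  obtain ⟨C, hC0, hexp⟩ := hlam.exists_expansion hf hh hτ le_rfl hT.le htr hlc hL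
  have hD : (∫ t in (0 : ℝ)..T,
        -inner ℝ (lam t) (dDelay f (h t) (h (t - τ)) t w (deriv h (t - τ))))
      = ∫ t in (0 : ℝ)..T, inner ℝ (v t) (-deriv h (t - τ)) := by
    refine intervalIntegral.integral_congr fun t _ => ?_
    simp only [v, inner_transposeMul, inner_neg_right]
  rw [hD, hasDerivAt_iff_isLittleO, Asymptotics.isLittleO_iff]
  intro ε hε
  obtain ⟨δ, hδ, hδ'⟩ := hexp (ε / (3 * (Λ + 1))) (by positivity)
  have hF' := Asymptotics.isLittleO_iff.1 (hasDerivAt_iff_isLittleO.1 hF)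
    (by positivity : 0 < ε / 3)
  -- The first bound makes `ω = Λ * |τ' - τ|` admissible in the expansion; the second makes the
  -- quadratic term `J` at most `ε / 3 * |τ' - τ|`.
  have hr : 0 < min (δ / (Λ + 1)) (ε / (3 * (V * C * Λ * T + 1))) := by positivity
  filter_upwards [hF', Ioo_mem_nhds hτ (by linarith : τ < τ + 1), Metric.ball_mem_nhds τ hr]
    with τ' hFτ hτ' hball
  rw [Metric.mem_ball, Real.dist_eq] at hball
  have hd1 : Λ * |τ' - τ| ≤ δ := by
    have h1 := (hball.trans_le (min_le_left _ _)).le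
    rw [le_div_iff₀ (by linarith)] at h1
    linarith [abs_nonneg (τ' - τ)]
  have hd2 : V * C * Λ * T * |τ' - τ| ≤ ε / 3 := by
    have h1 := (hball.trans_le (min_le_right _ _)).le
    rw [le_div_iff₀ (by positivity)] at h1
    linarith [abs_nonneg (τ' - τ)]
  obtain ⟨u, huc, hu, huf, hloss⟩ := hδ' w τ' (h 0) (Λ * |τ' - τ|) hτ'.1 hτ'.2.le
    (by simpa using hδ.le) (by simpa using hδ.le) (by positivity) hd1 (fun r hr => by
      refine (hΛ _ ⟨by linarith [hr.1, hτ'.2], by linarith [hr.2, hτ'.1]⟩ _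
        ⟨by linarith [hr.1], by linarith [hr.2]⟩).trans (le_of_eq ?_)
      rw [abs_sub_comm τ' τ]
      congr 2
      ring)
  simp only [sub_self, map_zero, inner_zero_right, norm_zero, intervalIntegral.integral_zero,
    sub_zero, zero_add] at hloss huf
  have hu0 : u 0 = h 0 := by rw [← hu.start, glue_of_le le_rfl]
  set e : ℝ → Vec n := fun r => glue h 0 u r - h r with he
  have hlip0 : ∀ x ∈ Set.Icc 0 T, ∀ y ∈ Set.Icc 0 T,
      ‖(u x - h x) - (u y - h y)‖ ≤ C * (Λ * |τ' - τ|) * |x - y| := by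
    intro x hx y hy
    refine norm_sub_le_of_deriv_right (e := fun r => u r - h r) (huc.sub hh).continuousOn
      (fun t ht => ?_) (fun t ht => huf t ⟨ht.1, ht.2.le⟩) hx hy
    have h1 := hu.deriv_right t ht
    rw [glue_of_le ht.1] at h1
    exact (h1.congr (fun x hx => (glue_of_le (le_trans ht.1 hx)).symm)
      (glue_of_le ht.1).symm).sub (htr.deriv_right t ht)
  -- Since `e` vanishes on the history and at `0`, it factors through the 1-Lipschitz map `r ↦ max r
  -- 0`, so its bound on `[0, T]` extends to all times up to `T`.
  have hemax : ∀ r, e r = u (max r 0) - h (max r 0) := by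
    intro r
    rcases lt_or_ge r 0 with h1 | h1
    · simp only [he]
      rw [glue_of_lt h1, max_eq_right h1.le, hu0, sub_self, sub_self]
    · simp only [he]
      rw [glue_of_le h1, max_eq_left h1]
  have hlip : ∀ x ≤ T, ∀ y ≤ T, ‖e x - e y‖ ≤ C * (Λ * |τ' - τ|) * |x - y| := by
    intro x hx y hy
    rw [hemax x, hemax y]
    refine (hlip0 _ ⟨le_max_right _ _, max_le hx hT.le⟩ _
      ⟨le_max_right _ _, max_le hy hT.le⟩).trans ?_
    exact mul_le_mul_of_nonneg_left (abs_max_sub_max_le_abs _ _ _) (by positivity)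
  set J := ∫ t in (0 : ℝ)..T, inner ℝ (v t) (e (t - τ') - e (t - τ)) with hJ
  have hJle : |J| ≤ V * C * Λ * T * |τ' - τ| * |τ' - τ| := by
    rw [hJ, ← Real.norm_eq_abs]
    refine (intervalIntegral.norm_integral_le_of_norm_le_const
      (C := V * (C * (Λ * |τ' - τ|) * |τ' - τ|)) fun t ht => ?_).trans (le_of_eq ?_)
    · rw [Set.uIoc_of_le hT.le] at ht
      refine (norm_inner_le_norm _ _).trans (mul_le_mul (hV t ⟨ht.1.le, ht.2⟩) ?_
        (norm_nonneg _) hV0)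
      refine (hlip _ (by linarith [ht.2, hτ'.1]) _ (by linarith [ht.2])).trans (le_of_eq ?_)
      rw [abs_sub_comm τ' τ]
      congr 2
      ring
    · rw [sub_zero, abs_of_pos hT]
      ring
  have hsplit : (∫ t in (0 : ℝ)..T, inner ℝ (lam t) (dDelay f (h t) (h (t - τ)) t w
        (glue h 0 u (t - τ') - glue h 0 u (t - τ))))
      = (∫ t in (0 : ℝ)..T, inner ℝ (v t) (h (t - τ')))
        - (∫ t in (0 : ℝ)..T, inner ℝ (v t) (h (t - τ))) + J := by
    have hi : ∀ c, IntervalIntegrable (fun t => inner ℝ (v t) (h (t - c)))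
        MeasureTheory.volume 0 T := fun c => (hv.inner (hhs c)).intervalIntegrable _ _
    have hie : IntervalIntegrable (fun t => inner ℝ (v t) (e (t - τ') - e (t - τ)))
        MeasureTheory.volume 0 T := by
      refine intervalIntegrable_inner hv (IntervalIntegrable.sub ?_ ?_)
      · exact (intervalIntegrable_glue_sub hh huc 0 τ' 0 T).sub ((hhs τ').intervalIntegrable _ _)
      · exact (intervalIntegrable_glue_sub hh huc 0 τ 0 T).sub ((hhs τ).intervalIntegrable _ _)
    rw [hJ, ← intervalIntegral.integral_sub (hi τ') (hi τ),
      ← intervalIntegral.integral_add ((hi τ').sub (hi τ)) hie]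
    refine intervalIntegral.integral_congr fun t _ => ?_
    simp only [v]
    rw [← inner_transposeMul, ← inner_sub_right, ← inner_add_right]
    congr 1
    simp only [he]
    abel
  rw [loss_eq L hf hh hτ.le hT.le htr]
  rw [hsplit] at hloss
  rw [Real.norm_eq_abs, Real.norm_eq_abs] at hFτ ⊢
  set F₁ := ∫ t in (0 : ℝ)..T, inner ℝ (v t) (h (t - τ'))
  set F₀ := ∫ t in (0 : ℝ)..T, inner ℝ (v t) (h (t - τ))
  have hJ' : |J| ≤ ε / 3 * |τ' - τ| :=
    hJle.trans (mul_le_mul_of_nonneg_right hd2 (abs_nonneg _))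
  have hloss' : |loss L f τ' w 0 T h (h 0) - L (h T) - (F₁ - F₀ + J)| ≤ ε / 3 * |τ' - τ| := by
    refine hloss.trans ?_
    have h1 : Λ / (Λ + 1) ≤ 1 := (div_le_one (by linarith)).2 (by linarith)
    calc ε / (3 * (Λ + 1)) * (Λ * |τ' - τ|) = Λ / (Λ + 1) * (ε / 3 * |τ' - τ|) := by
          field_simp
      _ ≤ 1 * (ε / 3 * |τ' - τ|) := by gcongr
      _ = _ := one_mul _
  set S := (τ' - τ) • ∫ t in (0 : ℝ)..T, inner ℝ (v t) (-deriv h (t - τ))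
  calc |loss L f τ' w 0 T h (h 0) - L (h T) - S|
      = |(loss L f τ' w 0 T h (h 0) - L (h T) - (F₁ - F₀ + J)) + (F₁ - F₀ - S) + J| := by
        congr 1; ring
    _ ≤ ε / 3 * |τ' - τ| + ε / 3 * |τ' - τ| + ε / 3 * |τ' - τ| :=
        (abs_add_three _ _ _).trans (add_le_add (add_le_add hloss' hFτ) hJ')
    _ = ε * |τ' - τ| := by ring

end NDDE

/-! ### Independence of irrelevant values, and the theorem. -/

namespace NDDE

variable {n p : ℕ} {f : Field n p}

theorem IsTrajectory.congr {τ s B : ℝ} {w : Vec p} {h h' : ℝ → Vec n} (hτ : 0 ≤ τ)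
    (htr : IsTrajectory f τ w s B h (h s) h) (hhh : ∀ t ≤ B, h t = h' t) :
    IsTrajectory f τ w s B h' (h' s) h' where
  history _ _ := rfl
  start := rfl
  continuousOn := htr.continuousOn.congr fun t ht => (hhh t ht.2).symm
  deriv_right t ht := by
    rw [← hhh t ht.2.le, ← hhh (t - τ) (by linarith [ht.2])]
    refine (htr.deriv_right t ht).congr_of_eventuallyEq ?_ (hhh t ht.2.le).symm
    filter_upwards [mem_nhdsWithin_of_mem_nhds (Iio_mem_nhds ht.2)] with x hx
    exact (hhh x (le_of_lt hx)).symm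

theorem IsTrajectory.restart {τ s s' B : ℝ} {w : Vec p} {ψ h : ℝ → Vec n} {ξ : Vec n}
    (htr : IsTrajectory f τ w s B ψ ξ h) (hs : s ≤ s') :
    IsTrajectory f τ w s' B h (h s') h where
  history _ _ := rfl
  start := rfl
  continuousOn := htr.continuousOn.mono (Set.Icc_subset_Icc_left hs)
  deriv_right t ht := htr.deriv_right t ⟨hs.trans ht.1, ht.2⟩

theorem IsAdjoint.congr {L : Vec n → ℝ} {τ T : ℝ} {w : Vec p} {h h' lam lam' : ℝ → Vec n}
    (hτ : 0 ≤ τ) (hT : 0 ≤ T) (hlam : IsAdjoint L f τ w T h lam) (hhh : ∀ t ≤ T, h t = h' t)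
    (hll : ∀ t ∈ Set.Icc 0 T, lam t = lam' t) : IsAdjoint L f τ w T h' lam' where
  continuousOn := hlam.continuousOn.congr fun t ht => (hll t ht).symm
  terminal := by rw [← hll T ⟨hT, le_rfl⟩, ← hhh T le_rfl, hlam.terminal]
  deriv_left t ht := by
    have hind : (Set.Icc 0 (T - τ)).indicator
        (fun r => transposeMul (lam' (r + τ)) (dDelay f (h' (r + τ)) (h' r) (r + τ) w))
        = (Set.Icc 0 (T - τ)).indicator
          (fun r => transposeMul (lam (r + τ)) (dDelay f (h (r + τ)) (h r) (r + τ) w)) := by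
      refine Set.indicator_congr fun r hr => ?_
      rw [hll _ ⟨by linarith [hr.1], by linarith [hr.2]⟩, hhh _ (by linarith [hr.2]),
        hhh r (by linarith [hr.2])]
    rw [hind, ← hll t ⟨ht.1.le, ht.2⟩, ← hhh t ht.2, ← hhh (t - τ) (by linarith [ht.2])]
    refine (hlam.deriv_left t ht).congr_of_eventuallyEq ?_ (hll t ⟨ht.1.le, ht.2⟩).symm
    filter_upwards [mem_nhdsWithin_of_mem_nhds (Ioi_mem_nhds ht.1), self_mem_nhdsWithin] with x hx hx'
    exact (hll x ⟨le_of_lt hx, le_trans hx' ht.2⟩).symm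

end NDDE

theorem proposition1 (n p : ℕ)
    -- the vector field and the loss function
    (f : NDDE.Field n p) (hf : NDDE.IsC1 f) (L : NDDE.Vec n → ℝ)
    -- the delay, the final time, the parameters, the initial function
    (τ T : ℝ) (hτ : 0 < τ) (hT : 0 < T) (w : NDDE.Vec p)
    (φ : ℝ → NDDE.Vec n) (hφ : ContinuousOn φ (Set.Iic 0))
    -- the completed forward pass
    (h : ℝ → NDDE.Vec n) (hh : NDDE.IsTrajectory f τ w 0 T φ (φ 0) h)
    (hL : DifferentiableAt ℝ L (h T)) :
    -- near the given data, the output is a well-defined function of `w`, `τ`, `T` and `h(0)`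
    (∀ᶠ q : NDDE.Vec p × ℝ × ℝ × NDDE.Vec n in 𝓝 (w, τ, T, φ 0),
      ∃! x, NDDE.IsOutput f q.2.1 q.1 0 q.2.2.1 φ q.2.2.2 x) ∧
    -- the same for the dependence on the state at an intermediate time `s`
    (∀ s ∈ Set.Icc 0 T, ∀ᶠ ξ in 𝓝 (h s), ∃! x, NDDE.IsOutput f τ w s T h ξ x) ∧
    -- the adjoint equation has a solution
    (∃ lam, NDDE.IsAdjoint L f τ w T h lam) ∧
    ∀ lam, NDDE.IsAdjoint L f τ w T h lam →
      -- `lam` is the adjoint: `lam(s) = ∂L(h(T)) / ∂h(s)`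
      (∀ s ∈ Set.Icc 0 T,
        HasGradientAt (fun ξ => NDDE.loss L f τ w s T h ξ) (lam s) (h s)) ∧
      -- `dL/dw`
      HasGradientAt (fun w' => NDDE.loss L f τ w' 0 T φ (φ 0))
        (∫ t in T..0, -NDDE.transposeMul (lam t) (NDDE.dParam f (h t) (h (t - τ)) t w)) w ∧
      -- `dL/dτ`
      (ContDiffOn ℝ 1 φ (Set.Iic 0) →
        HasDerivAt (fun τ' => NDDE.loss L f τ' w 0 T φ (φ 0))
          (∫ t in T..0,
            inner ℝ (lam t) (NDDE.dDelay f (h t) (h (t - τ)) t w (deriv h (t - τ)))) τ) ∧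
      -- `dL/dh₀`
      HasGradientAt (fun ξ => NDDE.loss L f τ w 0 T φ ξ) (lam 0) (φ 0) ∧
      -- `dL/dT`
      HasDerivAt (fun T' => NDDE.loss L f τ w 0 T' φ (φ 0))
        (inner ℝ (lam T) (f (h T) (h (T - τ)) T w)) T := by
  have hhφ : ∀ t ≤ 0, h t = φ t := fun t ht =>
    ht.lt_or_eq.elim (hh.history t) fun h0 => by rw [h0, hh.start]
  have hcont : ContinuousOn h (Set.Iic T) := by
    rw [← Set.Iic_union_Icc_eq_Iic hT.le]
    exact (hφ.congr hhφ).union_of_isClosed hh.continuousOn isClosed_Iic isClosed_Icc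
  -- pass to a globally continuous path with the same values up to time `T`
  obtain ⟨g, hg, hhg⟩ : ∃ g : ℝ → NDDE.Vec n, Continuous g ∧ ∀ t ≤ T, h t = g t :=
    ⟨fun t => h (min t T), hcont.comp_continuous (continuous_id.min continuous_const)
      fun t => Set.mem_Iic.2 (min_le_right _ _), fun t ht => by simp only [min_eq_left ht]⟩
  have hφg : ∀ t ≤ 0, φ t = g t := fun t ht => by rw [← hhφ t ht, hhg t (ht.trans hT.le)]
  have hφg' : ∀ t < 0, φ t = g t := fun t ht => hφg t ht.le
  have htrs : ∀ s ∈ Set.Icc 0 T, NDDE.IsTrajectory f τ w s T g (g s) g := fun s hs =>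
    (hh.restart hs.1).congr hτ.le hhg
  have htr := htrs 0 ⟨le_rfl, hT.le⟩
  rw [hhg T le_rfl] at hL
  rw [hφg 0 le_rfl]
  refine ⟨?_, fun s hs => ?_, ?_, fun lam₀ hlam₀ => ?_⟩
  · filter_upwards [htr.eventually_existsUnique_isOutput hf hg hτ hT] with q hq
    rwa [NDDE.isOutput_congr_history hφg']
  · rw [hhg s hs.2]
    filter_upwards [(htrs s hs).eventually_existsUnique_isOutput_state hf hg hτ hs.2] with ξ hξ
    rwa [NDDE.isOutput_congr_history fun t ht => hhg t (ht.le.trans hs.2)]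
  · obtain ⟨lam, hlam⟩ := NDDE.exists_isAdjoint hf L hτ hT w hg
    exact ⟨lam, hlam.congr hτ.le hT.le (fun t ht => (hhg t ht).symm) fun _ _ => rfl⟩
  -- Values of an adjoint solution outside `[0, T]` are irrelevant, so it is replaced by a globally
  -- continuous one.
  obtain ⟨lam, hlc, hll⟩ : ∃ lam : ℝ → NDDE.Vec n, Continuous lam ∧
      ∀ t ∈ Set.Icc 0 T, lam₀ t = lam t :=
    ⟨Set.IccExtend hT.le ((Set.Icc 0 T).domRestrict lam₀),
      (continuousOn_iff_continuous_domRestrict.1 hlam₀.continuousOn).Icc_extend',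
      fun t ht => by rw [Set.IccExtend_of_mem hT.le _ ht, Set.domRestrict_apply]⟩
  have hlam : NDDE.IsAdjoint L f τ w T g lam := hlam₀.congr hτ.le hT.le hhg hll
  have hloss : ∀ (τ' : ℝ) (w' : NDDE.Vec p) (T' : ℝ) (ξ : NDDE.Vec n),
      NDDE.loss L f τ' w' 0 T' φ ξ = NDDE.loss L f τ' w' 0 T' g ξ := fun τ' w' T' ξ =>
    NDDE.loss_congr_history hφg'
  simp only [hloss]
  have hstate : ∀ s ∈ Set.Icc 0 T,
      HasGradientAt (fun ξ => NDDE.loss L f τ w s T g ξ) (lam s) (g s) := fun s hs =>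
    NDDE.hasGradientAt_loss_state hf hg hτ hs.1 hs.2 (htrs s hs) hlc hlam hL
  refine ⟨fun s hs => ?_, ?_, fun hC => ?_, ?_, ?_⟩
  · rw [hll s hs, hhg s hs.2]
    simp only [NDDE.loss_congr_history (L := L) (f := f) (τ := τ) (w := w) (B := T)
      fun t (ht : t < s) => hhg t (ht.le.trans hs.2)]
    exact hstate s hs
  · convert NDDE.hasGradientAt_loss_param hf hg hτ le_rfl hT.le htr hlc hlam hL using 1
    rw [intervalIntegral.integral_symm, intervalIntegral.integral_neg, neg_neg]
    refine intervalIntegral.integral_congr fun t ht => ?_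
    rw [Set.uIcc_of_le hT.le] at ht
    rw [hll t ht, hhg t ht.2, hhg (t - τ) (by linarith [ht.2])]
  · convert NDDE.hasDerivAt_loss_delay hf hg hτ hT htr
      (hC.congr fun t ht => (hφg t ht).symm) hlc hlam hL using 1
    rw [intervalIntegral.integral_symm, ← intervalIntegral.integral_neg]
    refine intervalIntegral.integral_congr fun t ht => ?_
    rw [Set.uIcc_of_le hT.le] at ht
    -- As `t - τ < T`, the paths `h` and `g` agree on a whole neighbourhood of this point, so the
    -- two-sided derivatives coincide.
    have hder : deriv h (t - τ) = deriv g (t - τ) := by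
      refine Filter.EventuallyEq.deriv_eq ?_
      filter_upwards [Iio_mem_nhds (by linarith [ht.2] : t - τ < T)] with x hx
      exact hhg x (le_of_lt hx)
    rw [hll t ht, hhg t ht.2, hhg (t - τ) (by linarith [ht.2]), hder]
  · rw [hll 0 ⟨le_rfl, hT.le⟩]
    exact hstate 0 ⟨le_rfl, hT.le⟩
  · rw [hlam₀.terminal, hhg T le_rfl, hhg (T - τ) (by linarith)]
    exact NDDE.hasDerivAt_loss_time hf hg hτ hT htr hL
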